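/- Let $Z$ be the final precubical set: it has exactly one $n$-cube $z^n$ for every $n\ge 0$ (so its face maps are determined uniquely). Let $$|Z|=\Big(\coprod_{n\ge 0}\{z^n\}\times[0,1]^n\Big)\Big/\sim$$ be its geometric realization, regarded as an undirected topological space with the quotient topology, where $\sim$ is the equivalence relation generated by $(z^{n},\mathbf x)\sim(z^{n+1},\delta_i^\varepsilon\mathbf x)$ for all $n\ge 0$, $\mathbf{x}\in[0,1]^n$, $1\le i\le n+1$, $\varepsilon\in\{0,1\}$, and $\delta_i^\varepsilon(x_1,\dots,x_n)=(x_1,\dots,x_{i-1},\varepsilon,x_i,\dots,x_n)$. Write $[z^n;\mathbf x]$ for the class of $(z^n,\mathbf x)$. Let $Z^{(n)}$ be the $n$-skeleton of $Z$, consisting of the cubes $z^0,\dots,z^n$. For a pointed space $(X,x_0)$ let $J_n(X)$ be the quotient of $X^n$ by the equivalence relation generated by $(x_1,\dots,x_i,x_0,x_{i+1},\dots,x_{n-1})\sim(x_1,\dots,x_{i-1},x_0,x_i,x_{i+1},\dots,x_{n-1})$, and let $J(X)=\operatorname{colim}(J_0(X)\to J_1(X)\to J_2(X)\to\cdots)$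 be the James construction, where the maps add $x_0$ at the last position. Take $X=S^1\subset\mathbb C$ with base point $1$. **Proposition.** For every $n\ge 0$ there is a continuous map $f^{(n)}:|Z^{(n)}|\to J_n(S^1)$ with $$f^{(n)}\big([z^n;(x_1,\dots,x_n)]\big)=\big[e^{2\pi i x_1},\dots,e^{2\pi i x_n}\big]\quad\text{for all }(x_1,\dots,x_n)\in[0,1]^n ,$$ and the map $f=\operatorname{colim}_n f^{(n)}:|Z|\to J(S^1)$, that is, the map whose composition with $|Z^{(n)}|\to|Z|$ is $f^{(n)}$ followed by the canonical map $J_n(S^1)\to J(S^1)$, for every $n$, is (well defined and) a homeomorphism. Moreover, $|Z|$ is homotopy equivalent to the loop space $\Omega S^2$ (loops at any base point of $S^2$, with the compact-open topology). -/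

import Mathlib

open scoped unitInterval ContinuousMap

universe u

/-- A precubical set: sets of `n`-cubes for all `n` with face maps `d^ε_i` satisfying
`d^ε_i d^η_j = d^η_{j-1} d^ε_i` for `i < j`. Coordinates are numbered from `0`, and the pair
`i < j` is written as `i.castSucc < j.succ` with `i ≤ j`; `ε = false` is `0`, `ε = true` is `1`. -/
structure PrecubicalSet where
  cube : ℕ → Type u
  face : (n : ℕ) → Bool → Fin (n + 1) → cube (n + 1) → cube n
  face_face : ∀ (n : ℕ) (ε η : Bool) (i j : Fin (n + 1)), i ≤ j → ∀ c : cube (n + 2),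
    face n ε i (face (n + 1) η j.succ c) = face n η j (face (n + 1) ε i.castSucc c)

namespace PrecubicalSet

/-- A map of precubical sets. -/
@[ext]
structure Hom (K L : PrecubicalSet.{u}) where
  app : (n : ℕ) → K.cube n → L.cube n
  app_face : ∀ (n : ℕ) (ε : Bool) (i : Fin (n + 1)) (c : K.cube (n + 1)),
    app n (K.face n ε i c) = L.face n ε i (app (n + 1) c)

/-- The final precubical set `Z`, with exactly one cube `z^n` in each dimension `n`. -/
def final : PrecubicalSet.{u} where
  cube _ := PUnit
  face _ _ _ _ := PUnit.unit
  face_face _ _ _ _ _ _ _ := rfl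

/-- `Z` is a final object: every precubical set has exactly one map to it. -/
theorem existsUnique_hom_final (K : PrecubicalSet.{u}) : ∃! _f : Hom K final, True :=
  ⟨⟨fun _ _ => PUnit.unit, fun _ _ _ _ => rfl⟩, trivial, fun _ _ => rfl⟩

/-- The `n`-skeleton: the cubes of dimension at most `n`. -/
def skeleton (K : PrecubicalSet.{u}) (n : ℕ) : PrecubicalSet.{u} where
  cube k := {_c : K.cube k // k ≤ n}
  face k ε i c := ⟨K.face k ε i c.1, (Nat.le_succ k).trans c.2⟩
  face_face k ε η i j h c := Subtype.ext (K.face_face k ε η i j h c.1)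

/-- The inclusion of the `n`-skeleton. -/
def skeletonIncl (K : PrecubicalSet.{u}) (n : ℕ) : Hom (K.skeleton n) K where
  app _ c := c.1
  app_face _ _ _ _ := rfl

/-- The disjoint union of the cubes `{c} × [0,1]^n` over all `n` and all `n`-cubes `c`. -/
abbrev CubeSum (K : PrecubicalSet.{u}) : Type u :=
  Σ c : (Σ n, K.cube n), (Fin c.1 → I)

/-- The map `δ^ε_i : [0,1]^n → [0,1]^{n+1}` inserting the coordinate `ε` at the place `i`. -/
def coface {n : ℕ} (ε : Bool) (i : Fin (n + 1)) (x : Fin n → I) : Fin (n + 1) → I :=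
  i.insertNth (α := fun _ => I) (bif ε then 1 else 0) x

/-- The elementary identifications `(d^ε_i c, x) ∼ (c, δ^ε_i x)`. -/
inductive Glue (K : PrecubicalSet.{u}) : K.CubeSum → K.CubeSum → Prop
  | glue {n : ℕ} (ε : Bool) (i : Fin (n + 1)) (c : K.cube (n + 1)) (x : Fin n → I) :
      Glue K ⟨⟨n, K.face n ε i c⟩, x⟩ ⟨⟨n + 1, c⟩, coface ε i x⟩

/-- The geometric realization `|K|`, as a set: the quotient of the disjoint union of cubes by the
equivalence relation generated by `Glue`. -/
def Realization (K : PrecubicalSet.{u}) : Type u := Quot K.Glue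

/-- The quotient topology on `|K|`. -/
instance (K : PrecubicalSet.{u}) : TopologicalSpace K.Realization :=
  inferInstanceAs (TopologicalSpace (Quot K.Glue))

/-- The point `[c; x]` of `|K|`. -/
def Realization.mk {K : PrecubicalSet.{u}} {n : ℕ} (c : K.cube n) (x : Fin n → I) :
    K.Realization :=
  Quot.mk _ ⟨⟨n, c⟩, x⟩

/-- The map `|K| → |L|`, `[c; x] ↦ [g c; x]`, induced by a map `g : K → L`. -/
def Hom.realize {K L : PrecubicalSet.{u}} (g : Hom K L) : K.Realization → L.Realization :=
  Quot.map (fun p => ⟨⟨p.1.1, g.app _ p.1.2⟩, p.2⟩) (by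
    rintro _ _ ⟨ε, i, c, x⟩
    show L.Glue ⟨⟨_, g.app _ (K.face _ ε i c)⟩, x⟩ _
    rw [g.app_face]
    exact Glue.glue ε i (g.app _ c) x)

end PrecubicalSet

/-! The James construction on a pointed space `(X, x₀)`. -/

/-- The elementary identifications in `X^n`: the base point, as an entry of a sequence, may be
exchanged with a neighbouring entry. Here `y` is the sequence of the other entries. -/
inductive JamesRel {X : Type u} (x₀ : X) : (n : ℕ) → (Fin n → X) → (Fin n → X) → Prop
  | move {m : ℕ} (i : Fin m) (y : Fin m → X) :
      JamesRel x₀ (m + 1) (i.succ.insertNth (α := fun _ => X) x₀ y)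
        (i.castSucc.insertNth (α := fun _ => X) x₀ y)

/-- The `n`-th stage `J_n(X)`. -/
def JamesStage {X : Type u} (x₀ : X) (n : ℕ) : Type u := Quot (JamesRel x₀ n)

/-- The quotient topology on `J_n(X)`, from the product topology on `X^n`. -/
instance {X : Type u} [TopologicalSpace X] (x₀ : X) (n : ℕ) :
    TopologicalSpace (JamesStage x₀ n) :=
  inferInstanceAs (TopologicalSpace (Quot (JamesRel x₀ n)))

/-- The class of a sequence in `J_n(X)`. -/
def JamesStage.mk {X : Type u} (x₀ : X) {n : ℕ} (x : Fin n → X) : JamesStage x₀ n :=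
  Quot.mk _ x

/-- The inclusion `J_n(X) → J_{n+1}(X)`, adding `x₀` at the last position. -/
def JamesStage.incl {X : Type u} (x₀ : X) (n : ℕ) : JamesStage x₀ n → JamesStage x₀ (n + 1) :=
  Quot.map (fun x => Fin.snoc (α := fun _ => X) x x₀) (by
    rintro _ _ ⟨i, y⟩
    have h := JamesRel.move (x₀ := x₀) i.castSucc (Fin.snoc (α := fun _ => X) y x₀)
    have e (j : Fin (_ + 1)) :
        j.castSucc.insertNth (α := fun _ => X) x₀ (Fin.snoc (α := fun _ => X) y x₀) =
          Fin.snoc (α := fun _ => X) (j.insertNth (α := fun _ => X) x₀ y) x₀ := by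
      refine Fin.insertNth_eq_iff.2 ⟨?_, ?_⟩
      · simp
      · funext k
        refine Fin.lastCases ?_ (fun k => ?_) k
        · simp [Fin.removeNth]
        · simp [Fin.removeNth]
    rw [← e, ← e]
    exact h)

/-- The identifications `p ∼ incl p` in the disjoint union of the stages. -/
inductive JamesGlue {X : Type u} (x₀ : X) :
    (Σ n, JamesStage x₀ n) → (Σ n, JamesStage x₀ n) → Prop
  | glue {n : ℕ} (p : JamesStage x₀ n) : JamesGlue x₀ ⟨n, p⟩ ⟨n + 1, JamesStage.incl x₀ n p⟩

/-- The James construction `J(X)`, the colimit of `J_0(X) → J_1(X) → J_2(X) → ⋯`. -/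
def James {X : Type u} (x₀ : X) : Type u := Quot (JamesGlue x₀)

/-- The colimit topology on `J(X)`. -/
instance {X : Type u} [TopologicalSpace X] (x₀ : X) : TopologicalSpace (James x₀) :=
  inferInstanceAs (TopologicalSpace (Quot (JamesGlue x₀)))

/-- The canonical map `J_n(X) → J(X)`. -/
def James.ofStage {X : Type u} (x₀ : X) (n : ℕ) (p : JamesStage x₀ n) : James x₀ :=
  Quot.mk _ ⟨n, p⟩

/-- The map `f_n : [0,1]^n → J_n(S¹, 1)`, `(x_1, …, x_n) ↦ [e^{2πi x_1}, …, e^{2πi x_n}]`. -/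
noncomputable def circleCubeMap (n : ℕ) (x : Fin n → I) : JamesStage (1 : Circle) n :=
  JamesStage.mk 1 (fun k => Circle.exp (2 * Real.pi * (x k : ℝ)))

/-- The unit sphere `S²` in Euclidean `3`-space. -/
abbrev TwoSphere : Type := Metric.sphere (0 : EuclideanSpace ℝ (Fin 3)) 1

/-! Homeomorphism. A point of `|Z|` and a point of `J(S¹)` are both words, with letters in `[0,1]`
and in the circle respectively, in which certain letters may be deleted: `0` and `1` in the first
case, the base point in the second. Since `t ↦ e^{2πit}` identifies exactly `0` with `1`, applying
it letterwise is a bijection. The inverse picks an angle for each letter; the choice jumps at the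
base point, but the jump is invisible in `|Z|`. The inverse is continuous because `[0,1]^n → (S¹)^n`
is a continuous surjection from a compact space to a Hausdorff space, hence a quotient map.

Loop space. Left multiplication of words by points of the circle is used as a clutching function:
`Clutch` is `D² × |Z|` modulo `(x, z) ∼ (1, x z)` for `x` on the boundary, and it projects to `S² =
D²/∂D²` with fibres `|Z|`. It is contractible: its points are words whose first letter ranges over
the disc, and `Clutch.contract` shortens them from the front. Hence its homotopy fibre is the loop
space (`HoFiber.equivLoop`), and it remains to compare the fibre with the homotopy fibre.

Multiplication by `x` has a homotopy inverse, multiplication by `x⁻¹`, with a cancelling homotopy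
`RZ.cancel` continuous in `x`. The projection is therefore trivial up to homotopy both away from the
pole (fibre coordinate `Clutch.inner`) and near it (`Clutch.outer`). Points of the homotopy fibre
are carried along their paths in short steps by `Clutch.transport`, which keeps the inner coordinate
at small radii, the outer one at large radii, and changes between them in a band of intermediate
radii. The change has to respect both cancelling homotopies at once; `RZ.interp` supplies this
coherence. `PushFamily.homotopicRel_next` shows that a step does not change the homotopy class of
the self-map of the homotopy fibre, relative to the points already arrived at the pole. The step
length depends continuously on the path and has no positive lower bound in general, so infinitely
many steps are concatenated by `exists_homotopic_limit`. The limit is a map to the fibre which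
restricts to the identity there. -/

open Topology

/-! ### The geometric realization of the final precubical set -/

/-- The geometric realization `|Z|` of the final precubical set. -/
abbrev RZ : Type := PrecubicalSet.final.{0}.Realization

namespace RZ

/-- The point `[z^n; u]`. -/
def mk {n : ℕ} (u : Fin n → I) : RZ :=
  PrecubicalSet.Realization.mk (K := PrecubicalSet.final.{0}) (n := n) PUnit.unit u

theorem mk_coface {n : ℕ} (ε : Bool) (i : Fin (n + 1)) (u : Fin n → I) :
    mk (PrecubicalSet.coface ε i u) = mk u :=
  (Quot.sound (PrecubicalSet.Glue.glue (K := PrecubicalSet.final.{0}) ε i PUnit.unit u)).symm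

theorem mk_insertNth {n : ℕ} {t : I} (ht : t = 0 ∨ t = 1) (i : Fin (n + 1)) (u : Fin n → I) :
    mk (i.insertNth (α := fun _ => I) t u) = mk u := by
  rcases ht with rfl | rfl
  · exact mk_coface false i u
  · exact mk_coface true i u

theorem ind {P : RZ → Prop} (h : ∀ (n : ℕ) (u : Fin n → I), P (mk u)) (z : RZ) : P z := by
  induction z using Quot.ind with
  | mk p => obtain ⟨⟨n, c⟩, u⟩ := p; exact h n u

/-- Maps out of `|Z|` are compatible families of maps out of the cubes. -/
def lift {α : Type*} (g : ∀ n : ℕ, (Fin n → I) → α)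
    (h : ∀ (n : ℕ) (ε : Bool) (i : Fin (n + 1)) (u : Fin n → I),
      g (n + 1) (PrecubicalSet.coface ε i u) = g n u) : RZ → α :=
  Quot.lift (fun p => g p.1.1 p.2) (by rintro _ _ ⟨ε, i, c, x⟩; exact (h _ ε i x).symm)

theorem continuous_mk (n : ℕ) : Continuous (mk : (Fin n → I) → RZ) :=
  (continuous_quot_mk (r := PrecubicalSet.Glue PrecubicalSet.final.{0})).comp
    (@continuous_sigmaMk _ (fun c : (Σ n, PrecubicalSet.final.{0}.cube n) => Fin c.1 → I) _
      ⟨n, PUnit.unit⟩)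

theorem continuous_iff {α : Type*} [TopologicalSpace α] {g : RZ → α} :
    Continuous g ↔ ∀ n : ℕ, Continuous fun u : Fin n → I => g (mk u) := by
  refine ⟨fun h n => h.comp (continuous_mk n), fun h => ?_⟩
  refine (isQuotientMap_quot_mk (r := PrecubicalSet.Glue PrecubicalSet.final.{0})).continuous_iff.2 ?_
  exact continuous_sigma fun c => h c.1

/-- The product with a locally compact space preserves quotient maps. This gives joint continuity
for maps with a parameter in `I` or `ℝ`. -/
theorem continuous_prod_iff {α Y : Type*} [TopologicalSpace α] [TopologicalSpace Y]
    [LocallyCompactSpace Y] {g : RZ × Y → α} :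
    Continuous g ↔ ∀ n : ℕ, Continuous fun p : (Fin n → I) × Y => g (mk p.1, p.2) := by
  refine ⟨fun h n => h.comp (((continuous_mk n).comp continuous_fst).prodMk continuous_snd),
    fun h => ?_⟩
  refine (isQuotientMap_quot_mk
    (r := PrecubicalSet.Glue PrecubicalSet.final.{0})).continuous_lift_prod_left ?_
  have h2 : Continuous ((fun p : (PrecubicalSet.CubeSum PrecubicalSet.final.{0}) × Y =>
      g (Quot.mk _ p.1, p.2)) ∘ (Homeomorph.sigmaProdDistrib).symm) :=
    continuous_sigma fun c => h c.1
  exact (Homeomorph.sigmaProdDistrib.symm.comp_continuous_iff').1 h2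

end RZ

/-! ### The exponential parametrization of the circle by the unit interval -/

/-- The map `t ↦ e^{2πit}`. -/
noncomputable def circleExp (t : I) : Circle := Circle.exp (2 * Real.pi * (t : ℝ))

theorem continuous_circleExp : Continuous circleExp := by
  unfold circleExp; fun_prop

@[simp] theorem circleExp_zero : circleExp 0 = 1 := by simp [circleExp]

@[simp] theorem circleExp_one : circleExp 1 = 1 := by simp [circleExp]

theorem circleExp_eq_iff {s t : I} :
    circleExp s = circleExp t ↔ s = t ∨ ((s = 0 ∨ s = 1) ∧ (t = 0 ∨ t = 1)) := by
  constructor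
  · intro h
    rw [circleExp, circleExp, Circle.exp_eq_exp] at h
    obtain ⟨m, hm⟩ := h
    have hpi := Real.pi_pos
    have h1 : (s : ℝ) = t + m := by
      have : 2 * Real.pi * ((s : ℝ) - (t + m)) = 0 := by linarith
      have := (mul_eq_zero.1 this).resolve_left (by positivity)
      linarith
    have hs := s.2; have ht := t.2
    have hm1 : m ≤ 1 := by
      have : (m : ℝ) ≤ 1 := by linarith [hs.2, ht.1]
      exact_mod_cast this
    have hm2 : -1 ≤ m := by
      have : (-1 : ℝ) ≤ m := by linarith [hs.1, ht.2]
      exact_mod_cast this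
    have : m = -1 ∨ m = 0 ∨ m = 1 := by omega
    rcases this with rfl | rfl | rfl
    · right
      push_cast at h1
      exact ⟨Or.inl (Subtype.ext (show (s : ℝ) = 0 by linarith [hs.1, ht.2])),
        Or.inr (Subtype.ext (show (t : ℝ) = 1 by linarith [hs.1, ht.2]))⟩
    · left
      exact Subtype.ext (by simpa using h1)
    · right
      push_cast at h1
      exact ⟨Or.inr (Subtype.ext (show (s : ℝ) = 1 by linarith [hs.2, ht.1])),
        Or.inl (Subtype.ext (show (t : ℝ) = 0 by linarith [hs.2, ht.1]))⟩
  · rintro (rfl | ⟨rfl | rfl, rfl | rfl⟩) <;> simp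

theorem circleExp_surjective : Function.Surjective circleExp := by
  intro x
  have hpi := Real.pi_pos
  obtain ⟨θ, rfl⟩ : ∃ θ : ℝ, Circle.exp θ = x := ⟨_, Circle.exp_arg x⟩
  refine ⟨⟨Int.fract (θ / (2 * Real.pi)), Int.fract_nonneg _, (Int.fract_lt_one _).le⟩, ?_⟩
  rw [circleExp, Circle.exp_eq_exp]
  refine ⟨-⌊θ / (2 * Real.pi)⌋, ?_⟩
  have : θ = 2 * Real.pi * (⌊θ / (2 * Real.pi)⌋ + Int.fract (θ / (2 * Real.pi))) := by
    rw [Int.floor_add_fract]; field_simp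
  push_cast
  linarith

/-- A (discontinuous) section of `circleExp`. -/
noncomputable def circleAngle (x : Circle) : I := Function.surjInv circleExp_surjective x

@[simp] theorem circleExp_circleAngle (x : Circle) : circleExp (circleAngle x) = x :=
  Function.surjInv_eq circleExp_surjective x

theorem circleAngle_circleExp (t : I) :
    circleAngle (circleExp t) = t ∨
      ((circleAngle (circleExp t) = 0 ∨ circleAngle (circleExp t) = 1) ∧ (t = 0 ∨ t = 1)) :=
  circleExp_eq_iff.1 (circleExp_circleAngle _)

theorem circleAngle_one : circleAngle 1 = 0 ∨ circleAngle 1 = 1 := by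
  have := circleAngle_circleExp 0
  rw [circleExp_zero] at this
  tauto

/-- A continuous surjection from a compact space to a Hausdorff space stays a quotient map after
taking the product with any space. -/
theorem isQuotientMap_prodMap_id {X B Y : Type*} [TopologicalSpace X] [TopologicalSpace B]
    [TopologicalSpace Y] [CompactSpace X] [T2Space B] {q : X → B} (hq : Continuous q)
    (hs : Function.Surjective q) : IsQuotientMap (Prod.map q (id : Y → Y)) := by
  have h : IsProperMap (Prod.map q (id : Y → Y)) := hq.isProperMap.prodMap isProperMap_id
  exact h.isClosedMap.isQuotientMap h.continuous (hs.prodMap Function.surjective_id)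

/-- A map on `I × Y` which agrees on `{0} × Y` and `{1} × Y` descends to `Circle × Y`. -/
theorem circle_descend_apply {Y α : Type*} {g : I → Y → α} (h : ∀ y, g 0 y = g 1 y) (t : I) (y : Y) :
    g (circleAngle (circleExp t)) y = g t y := by
  rcases circleAngle_circleExp t with h1 | ⟨h1 | h1, rfl | rfl⟩ <;> rw [h1] <;> simp [h]

theorem continuous_circle_descend {Y α : Type*} [TopologicalSpace Y] [TopologicalSpace α]
    {g : I → Y → α} (h : ∀ y, g 0 y = g 1 y) (hg : Continuous fun p : I × Y => g p.1 p.2) :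
    Continuous fun p : Circle × Y => g (circleAngle p.1) p.2 := by
  refine (isQuotientMap_prodMap_id (Y := Y) continuous_circleExp
    circleExp_surjective).continuous_iff.2 ?_
  convert hg using 2 with p
  exact circle_descend_apply h p.1 p.2

/-! ### The homeomorphism with the James construction -/

namespace JamesStage

variable {X : Type u} (x₀ : X)

/-- Repeated exchange with the right neighbour brings the base point to the last place, hence the
descending induction on the position. -/
theorem mk_insertNth_eq_last {n : ℕ} (i : Fin (n + 1)) (v : Fin n → X) :
    mk x₀ (i.insertNth (α := fun _ => X) x₀ v) = incl x₀ n (mk x₀ v) := by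
  induction i using Fin.reverseInduction with
  | last => rw [Fin.insertNth_last']; rfl
  | cast i ih =>
    rw [← ih]
    exact (Quot.sound (JamesRel.move i v)).symm

theorem continuous_mk [TopologicalSpace X] (n : ℕ) :
    Continuous (mk x₀ : (Fin n → X) → JamesStage x₀ n) :=
  continuous_quot_mk

theorem continuous_incl [TopologicalSpace X] (n : ℕ) : Continuous (incl x₀ n) := by
  refine continuous_quot_lift _ ?_
  refine (continuous_mk x₀ (n + 1)).comp (continuous_pi fun k => ?_)
  refine Fin.lastCases ?_ (fun k => ?_) k
  · simpa using continuous_const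
  · simpa using continuous_apply k

/-- The iterated inclusion of stages. -/
def inclLE {k n : ℕ} (h : k ≤ n) : JamesStage x₀ k → JamesStage x₀ n :=
  Nat.leRecOn h (fun {m} => incl x₀ m)

theorem inclLE_self (n : ℕ) (p : JamesStage x₀ n) : inclLE x₀ le_rfl p = p :=
  Nat.leRecOn_self _

theorem inclLE_succ_left {k n : ℕ} (h : k + 1 ≤ n) (p : JamesStage x₀ k) :
    inclLE x₀ h (incl x₀ k p) = inclLE x₀ ((Nat.le_succ k).trans h) p :=
  Nat.leRecOn_succ_left p ((Nat.le_succ k).trans h) h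

theorem inclLE_succ {k n : ℕ} (h : k ≤ n) (p : JamesStage x₀ k) :
    inclLE x₀ (h.trans (Nat.le_succ n)) p = incl x₀ n (inclLE x₀ h p) :=
  Nat.leRecOn_succ h p

theorem continuous_inclLE [TopologicalSpace X] {k n : ℕ} (h : k ≤ n) :
    Continuous (inclLE x₀ h) := by
  induction h with
  | refl => exact continuous_id.congr fun p => (inclLE_self x₀ _ p).symm
  | step h ih => exact ((continuous_incl x₀ _).comp ih).congr fun p => (inclLE_succ x₀ h p).symm

end JamesStage

namespace James

variable {X : Type u} (x₀ : X)

theorem ofStage_incl (n : ℕ) (p : JamesStage x₀ n) :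
    ofStage x₀ (n + 1) (JamesStage.incl x₀ n p) = ofStage x₀ n p :=
  (Quot.sound (JamesGlue.glue p)).symm

theorem ofStage_inclLE {k n : ℕ} (h : k ≤ n) (p : JamesStage x₀ k) :
    ofStage x₀ n (JamesStage.inclLE x₀ h p) = ofStage x₀ k p := by
  induction h with
  | refl => rw [JamesStage.inclLE_self]
  | step h ih => rw [← ih]; erw [JamesStage.inclLE_succ x₀ h p]; rw [ofStage_incl]

theorem continuous_ofStage [TopologicalSpace X] (n : ℕ) : Continuous (ofStage x₀ n) :=
  (continuous_quot_mk (r := JamesGlue x₀)).comp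
    (@continuous_sigmaMk _ (fun n => JamesStage x₀ n) _ n)

end James

theorem circleCubeMap_coface {n : ℕ} (ε : Bool) (i : Fin (n + 1)) (x : Fin n → I) :
    circleCubeMap (n + 1) (PrecubicalSet.coface ε i x) =
      JamesStage.incl 1 n (circleCubeMap n x) := by
  have : (fun k => circleExp (PrecubicalSet.coface ε i x k)) =
      i.insertNth (α := fun _ => Circle) 1 (fun k => circleExp (x k)) := by
    symm
    refine Fin.insertNth_eq_iff.2 ⟨?_, ?_⟩
    · cases ε <;> simp [PrecubicalSet.coface]
    · funext k; simp [PrecubicalSet.coface, Fin.removeNth]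
  exact (congrArg (JamesStage.mk 1) this).trans (JamesStage.mk_insertNth_eq_last 1 i _)

theorem continuous_circleCubeMap (n : ℕ) : Continuous (circleCubeMap n) :=
  (JamesStage.continuous_mk 1 n).comp
    (continuous_pi fun k => continuous_circleExp.comp (continuous_apply k))

/-- The map `f^{(n)}` on the skeleton. -/
noncomputable def skeletonToJames (n : ℕ) :
    C((PrecubicalSet.final.{0}.skeleton n).Realization, JamesStage (1 : Circle) n) where
  toFun := Quot.lift (fun p => JamesStage.inclLE 1 p.1.2.2 (circleCubeMap p.1.1 p.2)) (by
    rintro _ _ ⟨ε, i, c, x⟩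
    rw [circleCubeMap_coface]
    exact (JamesStage.inclLE_succ_left _ c.2 _).symm)
  continuous_toFun := by
    refine continuous_quot_lift _ (continuous_sigma fun c => ?_)
    exact (JamesStage.continuous_inclLE 1 c.2.2).comp (continuous_circleCubeMap c.1)

/-- A recovered angle differs from the original one only when both are end points of the interval.
Such a coordinate can be deleted on both sides, which lowers the dimension. -/
theorem RZ.mk_circleAngle_circleExp {n : ℕ} (u : Fin n → I) :
    RZ.mk (fun k => circleAngle (circleExp (u k))) = RZ.mk u := by
  induction n with
  | zero => congr 1; exact Subsingleton.elim _ _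
  | succ n ih =>
    by_cases h : ∀ k, circleAngle (circleExp (u k)) = u k
    · simp only [h]
    · push Not at h
      obtain ⟨k, hk⟩ := h
      obtain ⟨h1, h2⟩ := (circleAngle_circleExp (u k)).resolve_left hk
      have e1 : (fun k => circleAngle (circleExp (u k))) =
          k.insertNth (α := fun _ => I) (circleAngle (circleExp (u k)))
            (fun j => circleAngle (circleExp (u (k.succAbove j)))) :=
        (Fin.insertNth_eq_iff.2 ⟨rfl, rfl⟩).symm
      have e2 : u = k.insertNth (α := fun _ => I) (u k) (fun j => u (k.succAbove j)) :=
        (Fin.insertNth_eq_iff.2 ⟨rfl, rfl⟩).symm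
      rw [e1, mk_insertNth h1, ih fun j => u (k.succAbove j)]
      conv_rhs => rw [e2]
      rw [mk_insertNth h2]

/-- The map `J_n(S¹) → |Z|` taking the angles of the letters of a word. -/
noncomputable def jamesStageToRZ (n : ℕ) : JamesStage (1 : Circle) n → RZ :=
  Quot.lift (fun v => RZ.mk fun k => circleAngle (v k)) (by
    rintro _ _ ⟨i, y⟩
    have key (j : Fin (_ + 1)) : (fun k => circleAngle
        (j.insertNth (α := fun _ => Circle) 1 y k)) =
          j.insertNth (α := fun _ => I) (circleAngle 1) (fun k => circleAngle (y k)) := by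
      symm
      exact Fin.insertNth_eq_iff.2 ⟨by simp, by funext k; simp [Fin.removeNth]⟩
    simp only [key, RZ.mk_insertNth circleAngle_one])

theorem jamesStageToRZ_mk {n : ℕ} (v : Fin n → Circle) :
    jamesStageToRZ n (JamesStage.mk 1 v) = RZ.mk fun k => circleAngle (v k) := rfl

theorem jamesStageToRZ_circleCubeMap {n : ℕ} (u : Fin n → I) :
    jamesStageToRZ n (circleCubeMap n u) = RZ.mk u :=
  RZ.mk_circleAngle_circleExp u

theorem continuous_jamesStageToRZ (n : ℕ) : Continuous (jamesStageToRZ n) := by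
  refine continuous_quot_lift _ ?_
  have hc : Continuous fun (u : Fin n → I) k => circleExp (u k) :=
    continuous_pi fun k => continuous_circleExp.comp (continuous_apply k)
  have hs : Function.Surjective fun (u : Fin n → I) k => circleExp (u k) := fun v =>
    ⟨fun k => circleAngle (v k), by simp⟩
  refine (IsQuotientMap.of_surjective_continuous hs hc).continuous_iff.2 ?_
  exact (RZ.continuous_mk n).congr fun u => (RZ.mk_circleAngle_circleExp u).symm

/-- The homeomorphism `|Z| ≃ J(S¹)`. -/
noncomputable def realizationHomeoJames : RZ ≃ₜ James (1 : Circle) where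
  toFun := RZ.lift (fun n u => James.ofStage 1 n (circleCubeMap n u)) (by
    intro n ε i u
    rw [circleCubeMap_coface, James.ofStage_incl])
  invFun := Quot.lift (fun p => jamesStageToRZ p.1 p.2) (by
    rintro _ _ ⟨p⟩
    induction p using Quot.ind with
    | mk v =>
      have := JamesStage.mk_insertNth_eq_last (1 : Circle) (Fin.last _) v
      change _ = jamesStageToRZ _ (JamesStage.incl 1 _ (JamesStage.mk 1 v))
      rw [← this]
      have key : (fun k => circleAngle
        ((Fin.last _).insertNth (α := fun _ => Circle) 1 v k)) =
          (Fin.last _).insertNth (α := fun _ => I) (circleAngle 1) (fun k => circleAngle (v k)) := by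
        symm
        exact Fin.insertNth_eq_iff.2 ⟨by simp, by funext k; simp [Fin.removeNth]⟩
      rw [jamesStageToRZ_mk, key, RZ.mk_insertNth circleAngle_one]
      rfl)
  left_inv := RZ.ind fun n u => jamesStageToRZ_circleCubeMap u
  right_inv := by
    intro p
    induction p using Quot.ind with
    | mk p =>
      obtain ⟨n, p⟩ := p
      induction p using Quot.ind with
      | mk v =>
        change James.ofStage 1 n (JamesStage.mk 1 fun k => circleExp (circleAngle (v k))) = _
        simp only [circleExp_circleAngle]
        rfl
  continuous_toFun := RZ.continuous_iff.2 fun n =>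
    (James.continuous_ofStage 1 n).comp (continuous_circleCubeMap n)
  continuous_invFun := continuous_quot_lift _ (continuous_sigma continuous_jamesStageToRZ)

theorem realizationHomeoJames_skeleton :
    ∃ (fs : ∀ n : ℕ, C((PrecubicalSet.final.{0}.skeleton n).Realization,
          JamesStage (1 : Circle) n))
        (f : PrecubicalSet.final.{0}.Realization ≃ₜ James (1 : Circle)),
      (∀ (n : ℕ) (x : Fin n → I),
        fs n (PrecubicalSet.Realization.mk ⟨PUnit.unit, le_refl n⟩ x) = circleCubeMap n x) ∧
      (∀ (n : ℕ) (p : (PrecubicalSet.final.{0}.skeleton n).Realization),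
        f ((PrecubicalSet.final.{0}.skeletonIncl n).realize p) =
          James.ofStage (1 : Circle) n (fs n p)) := by
  refine ⟨skeletonToJames, realizationHomeoJames,
    fun n x => JamesStage.inclLE_self 1 n _, fun n p => ?_⟩
  induction p using Quot.ind with
  | mk p =>
    obtain ⟨⟨k, c⟩, x⟩ := p
    exact (James.ofStage_inclLE 1 c.2 _).symm

/-! ### Left multiplication by letters -/

namespace RZ

/-- Left multiplication of a word by a letter. -/
def cons (t : I) : RZ → RZ :=
  lift (fun n u => mk (Fin.cons (α := fun _ : Fin (n + 1) => I) t u)) (by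
    intro n ε i u
    rw [PrecubicalSet.coface, ← Fin.insertNth_succ_cons]
    exact mk_coface ε i.succ _)

@[simp] theorem cons_mk (t : I) {n : ℕ} (u : Fin n → I) :
    cons t (mk u) = mk (Fin.cons (α := fun _ : Fin (n + 1) => I) t u) := rfl

theorem cons_of_eq {t : I} (ht : t = 0 ∨ t = 1) (z : RZ) : cons t z = z := by
  induction z using ind with
  | h n u => rw [cons_mk, ← Fin.insertNth_zero', mk_insertNth ht]

@[simp] theorem cons_zero (z : RZ) : cons 0 z = z := cons_of_eq (Or.inl rfl) z

@[simp] theorem cons_one (z : RZ) : cons 1 z = z := cons_of_eq (Or.inr rfl) z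

theorem continuous_uncurry_cons : Continuous fun p : I × RZ => cons p.1 p.2 := by
  suffices h : Continuous fun p : RZ × I => cons p.2 p.1 from h.comp continuous_swap
  refine continuous_prod_iff.2 fun n => ?_
  have hc : Continuous fun p : (Fin n → I) × I =>
      (Fin.cons (α := fun _ : Fin (n + 1) => I) p.2 p.1 : Fin (n + 1) → I) := ?_
  · exact (continuous_mk (n + 1)).comp hc
  refine continuous_pi fun k => ?_
  refine Fin.cases ?_ (fun k => ?_) k
  · simpa using continuous_snd
  · simpa using (by fun_prop : Continuous fun p : (Fin n → I) × I => p.1 k)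

@[fun_prop] theorem _root_.Continuous.rzCons {X : Type*} [TopologicalSpace X] {t : X → I}
    {z : X → RZ} (ht : Continuous t) (hz : Continuous z) : Continuous fun a => RZ.cons (t a) (z a) :=
  continuous_uncurry_cons.comp (ht.prodMk hz)

/-- Left multiplication by a point of the circle. -/
noncomputable def mul (x : Circle) (z : RZ) : RZ := cons (circleAngle x) z

theorem mul_circleExp (t : I) (z : RZ) : mul (circleExp t) z = cons t z :=
  circle_descend_apply (g := fun t z => cons t z) (by simp) t z

@[simp] theorem mul_one (z : RZ) : mul 1 z = z := by
  rw [← circleExp_zero, mul_circleExp, cons_zero]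

@[fun_prop] theorem _root_.Continuous.rzMul {X : Type*} [TopologicalSpace X] {x : X → Circle}
    {z : X → RZ} (hx : Continuous x) (hz : Continuous z) : Continuous fun a => RZ.mul (x a) (z a) :=
  (continuous_circle_descend (g := fun t z => cons t z) (by simp) (by fun_prop)).comp
    (hx.prodMk hz)

theorem _root_.ContinuousOn.rzMul {X : Type*} [TopologicalSpace X] {x : X → Circle}
    {z : X → RZ} {s : Set X} (hx : ContinuousOn x s) (hz : ContinuousOn z s) :
    ContinuousOn (fun a => RZ.mul (x a) (z a)) s :=
  (Continuous.rzMul continuous_fst continuous_snd).comp_continuousOn (hx.prodMk hz)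

end RZ

/-- The retraction of the real line onto the unit interval. -/
noncomputable def clampI (r : ℝ) : I := Set.projIcc 0 1 zero_le_one r

@[fun_prop] theorem continuous_clampI : Continuous clampI :=
  continuous_projIcc (h := zero_le_one)

theorem clampI_of_nonpos {r : ℝ} (h : r ≤ 0) : clampI r = 0 := Set.projIcc_of_le_left _ h

theorem clampI_of_one_le {r : ℝ} (h : 1 ≤ r) : clampI r = 1 := Set.projIcc_of_right_le _ h

@[simp] theorem clampI_coe (t : I) : clampI t = t := Set.projIcc_val _ t

@[simp] theorem clampI_zero : clampI 0 = 0 := clampI_of_nonpos le_rfl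

@[simp] theorem clampI_one : clampI 1 = 1 := clampI_of_one_le le_rfl

theorem circleExp_symm (t : I) : circleExp (σ t) = (circleExp t)⁻¹ := by
  rw [circleExp, circleExp, ← Circle.exp_neg, Circle.exp_eq_exp]
  exact ⟨1, by simp only [unitInterval.coe_symm_eq]; push_cast; ring⟩

/-! ### Cancelling a letter against its inverse, and the coherence of the cancelling homotopies. -/

namespace RZ

/-- A homotopy from the identity to `z ↦ x x⁻¹ z`, in terms of the angle of `x`. -/
noncomputable def cancelAux (u : I) (p : I × RZ) : RZ :=
  cons (clampI (u + 1 - p.1)) (cons (clampI (2 - u - p.1)) p.2)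

/-- A homotopy from the identity of `|Z|` to `z ↦ x x⁻¹ z`. -/
noncomputable def cancel (x : Circle) (t : I) (z : RZ) : RZ := cancelAux (circleAngle x) (t, z)

/-- For `u = 0` the second letter stays at `1` and the first is `1 - t`; for `u = 1` the roles are
exchanged. In both cases one letter `1 - t` remains in front of the word, so the homotopy descends
to the circle. For `x = 1` it is thus a loop, in general not constant. -/
theorem cancelAux_zero_eq (p : I × RZ) : cancelAux 0 p = cancelAux 1 p := by
  have h1 : clampI ((1 : ℝ) + 1 - p.1) = 1 := clampI_of_one_le (by linarith [p.1.2.2])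
  have h2 : clampI ((2 : ℝ) - p.1) = 1 := clampI_of_one_le (by linarith [p.1.2.2])
  have h3 : (2 : ℝ) - 1 - p.1 = 1 - p.1 := by ring
  simp only [cancelAux, Set.Icc.coe_zero, Set.Icc.coe_one, h1, sub_zero, h2, cons_one, zero_add, h3]

theorem cancel_circleExp (u t : I) (z : RZ) : cancel (circleExp u) t z = cancelAux u (t, z) :=
  circle_descend_apply cancelAux_zero_eq u (t, z)

theorem continuous_cancelAux :
    Continuous fun p : I × I × RZ => cancelAux p.1 p.2 := by
  unfold cancelAux
  refine Continuous.rzCons ?_ (Continuous.rzCons ?_ ?_) <;> fun_prop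

theorem continuous_uncurry_cancel :
    Continuous fun p : Circle × I × RZ => cancel p.1 p.2.1 p.2.2 :=
  continuous_circle_descend cancelAux_zero_eq continuous_cancelAux

@[fun_prop] theorem _root_.Continuous.rzCancel {X : Type*} [TopologicalSpace X] {x : X → Circle}
    {t : X → I} {z : X → RZ} (hx : Continuous x) (ht : Continuous t) (hz : Continuous z) :
    Continuous fun a => RZ.cancel (x a) (t a) (z a) :=
  Continuous.comp (g := fun p : Circle × I × RZ => RZ.cancel p.1 p.2.1 p.2.2)
    (f := fun a => (x a, t a, z a)) continuous_uncurry_cancel (hx.prodMk (ht.prodMk hz))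

theorem _root_.ContinuousOn.rzCancel {X : Type*} [TopologicalSpace X] {x : X → Circle}
    {t : X → I} {z : X → RZ} {s : Set X} (hx : ContinuousOn x s) (ht : ContinuousOn t s)
    (hz : ContinuousOn z s) : ContinuousOn (fun a => RZ.cancel (x a) (t a) (z a)) s :=
  Continuous.comp_continuousOn (g := fun p : Circle × I × RZ => RZ.cancel p.1 p.2.1 p.2.2)
    (f := fun a => (x a, t a, z a)) continuous_uncurry_cancel (hx.prodMk (ht.prodMk hz))

@[simp] theorem cancel_zero (x : Circle) (z : RZ) : cancel x 0 z = z := by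
  obtain ⟨u, rfl⟩ := circleExp_surjective x
  rw [cancel_circleExp, cancelAux]
  simp only [Set.Icc.coe_zero, sub_zero]
  rw [clampI_of_one_le (by linarith [u.2.1]), clampI_of_one_le (by linarith [u.2.2])]
  simp

@[simp] theorem cancel_one (x : Circle) (z : RZ) : cancel x 1 z = mul x (mul x⁻¹ z) := by
  obtain ⟨u, rfl⟩ := circleExp_surjective x
  rw [cancel_circleExp, cancelAux, ← circleExp_symm, mul_circleExp, mul_circleExp]
  congr 1
  · simp
  · congr 1
    simp only [Set.Icc.coe_one]
    rw [show (2 : ℝ) - u - 1 = (σ u : I) by rw [unitInterval.coe_symm_eq]; ring, clampI_coe]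

/-- Auxiliary bump function, equal to `1` on `[1, 3]`. -/
noncomputable def bumpOuter (s : ℝ) : I := clampI (min s (4 - s))

/-- Auxiliary bump function, supported in `[1, 3]`, with maximum `1` at `2`. -/
noncomputable def bumpInner (s : ℝ) : I := clampI (min (s - 1) (3 - s))

@[fun_prop] theorem continuous_bumpOuter : Continuous bumpOuter := by unfold bumpOuter; fun_prop

@[fun_prop] theorem continuous_bumpInner : Continuous bumpInner := by unfold bumpInner; fun_prop

theorem bumpOuter_one : bumpOuter 1 = 1 := clampI_of_one_le (by norm_num)
theorem bumpOuter_three : bumpOuter 3 = 1 := clampI_of_one_le (by norm_num)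
theorem bumpOuter_zero : bumpOuter 0 = 0 := clampI_of_nonpos (by norm_num)
theorem bumpOuter_four : bumpOuter 4 = 0 := clampI_of_nonpos (by norm_num)
theorem bumpInner_one : bumpInner 1 = 0 := clampI_of_nonpos (by norm_num)
theorem bumpInner_two : bumpInner 2 = 1 := clampI_of_one_le (by norm_num)
theorem bumpInner_three : bumpInner 3 = 0 := clampI_of_nonpos (by norm_num)

/-- The first stage of `interp`: conjugating by the homotopy `cancel x⁻¹`. -/
noncomputable def interpA (x : Circle) (z : RZ) (s r : ℝ) : RZ :=
  mul x (cancel x⁻¹ (clampI r * bumpOuter s) z)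

/-- The second stage of `interp`: running `cancel x` backwards. -/
noncomputable def interpB (x : Circle) (z : RZ) (s r : ℝ) : RZ :=
  if s ≤ 1 then mul x (cancel x⁻¹ (bumpOuter s) z)
  else if s ≤ 3 then cancel x (σ (clampI r * bumpInner s)) (mul x z)
  else mul x (cancel x⁻¹ (bumpOuter s) z)

/-- The third stage of `interp`: running `cancel x` forwards. -/
noncomputable def interpC (x : Circle) (z : RZ) (s r : ℝ) : RZ :=
  if s ≤ 1 then mul x (cancel x⁻¹ (bumpOuter s) z)
  else if s ≤ 2 then cancel x (σ (σ (clampI r) * bumpInner s)) (mul x z)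
  else if s ≤ 3 then cancel x (clampI r) (cancel x (σ (bumpInner s)) (mul x z))
  else cancel x (clampI r) (mul x (cancel x⁻¹ (bumpOuter s) z))

/-- A family, parametrized by `s ∈ [0, 4]`, of paths in `|Z|` starting at `x z` and ending at points
of the form `x z'`, which interpolates between the constant path at `x z` and the path
`cancel x · (x z)`. -/
noncomputable def interp (x : Circle) (z : RZ) (s r : ℝ) : RZ :=
  if r ≤ 1 then interpA x z s r
  else if r ≤ 2 then interpB x z s (r - 1)
  else interpC x z s (r - 2)

/-- The end points of the paths `interp`, divided by `x`. -/
noncomputable def interpEnd (x : Circle) (z : RZ) (s : ℝ) : RZ :=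
  if s ≤ 1 then cancel x⁻¹ (bumpOuter s) z
  else if s ≤ 2 then mul x⁻¹ (mul x z)
  else if s ≤ 3 then mul x⁻¹ (cancel x (σ (bumpInner s)) (mul x z))
  else mul x⁻¹ (mul x (cancel x⁻¹ (bumpOuter s) z))

/-- Both `x · cancel x⁻¹ z` and `cancel x (x z)` are paths from `x z` to `x x⁻¹ x z`, but they need
not be homotopic. The remedy is the usual one that turns a homotopy equivalence into an adjoint one.
The end points `interpEnd` go from `z` to `x⁻¹ x z` along `cancel x⁻¹`, then on to `x⁻¹ x x⁻¹ x z`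
along `x⁻¹ · cancel x`, and return to `x⁻¹ x z` along `x⁻¹ x · cancel x⁻¹`. As `r` grows, `interpA`
creates an excursion along `x · cancel x⁻¹` and back; `interpB` inserts at its turning point a
backward and forward run along `cancel x`; `interpC` retracts the backward run while applying
`cancel x` to the part `s ≥ 2`. What remains at the last time is `x` times the path of end points.
-/
theorem continuous_interp :
    Continuous fun p : Circle × RZ × ℝ × ℝ => interp p.1 p.2.1 p.2.2.1 p.2.2.2 := by
  unfold interp
  refine Continuous.if_le ?_ (Continuous.if_le ?_ ?_ (by fun_prop) (by fun_prop) ?_)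
    (by fun_prop) (by fun_prop) ?_
  · unfold interpA; fun_prop
  · unfold interpB
    refine Continuous.if_le (by fun_prop) (Continuous.if_le (by fun_prop) (by fun_prop)
      (by fun_prop) (by fun_prop) ?_) (by fun_prop) (by fun_prop) ?_
    · rintro ⟨x, z, s, r⟩ h
      simp only at h
      simp [h, bumpInner_three, bumpOuter_three]
    · rintro ⟨x, z, s, r⟩ h
      simp only at h
      simp [h, bumpInner_one, bumpOuter_one]
  · unfold interpC
    refine Continuous.if_le (by fun_prop) (Continuous.if_le (by fun_prop) (Continuous.if_le
      (by fun_prop) (by fun_prop) (by fun_prop) (by fun_prop) ?_)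
      (by fun_prop) (by fun_prop) ?_) (by fun_prop) (by fun_prop) ?_
    · rintro ⟨x, z, s, r⟩ h
      simp only at h
      simp [h, bumpInner_three, bumpOuter_three]
    · rintro ⟨x, z, s, r⟩ h
      simp only at h
      norm_num [h, bumpInner_two]
    · rintro ⟨x, z, s, r⟩ h
      simp only at h
      simp [h, bumpInner_one, bumpOuter_one]
  · rintro ⟨x, z, s, r⟩ h
    simp only at h
    subst h
    norm_num [interpB, interpC]
    split_ifs <;> first | rfl | (exfalso; linarith)
  · rintro ⟨x, z, s, r⟩ h
    simp only at h
    subst h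
    norm_num [interpA, interpB]
    intro h1 h3
    have : bumpOuter s = 1 := clampI_of_one_le (le_min h1.le (by linarith))
    simp [this]

theorem continuous_interpEnd :
    Continuous fun p : Circle × RZ × ℝ => interpEnd p.1 p.2.1 p.2.2 := by
  unfold interpEnd
  refine Continuous.if_le (by fun_prop) (Continuous.if_le (by fun_prop) (Continuous.if_le
    (by fun_prop) (by fun_prop) (by fun_prop) (by fun_prop) ?_)
    (by fun_prop) (by fun_prop) ?_) (by fun_prop) (by fun_prop) ?_
  · rintro ⟨x, z, s⟩ h
    simp only at h
    simp [h, bumpInner_three, bumpOuter_three]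
  · rintro ⟨x, z, s⟩ h
    simp only at h
    norm_num [h, bumpInner_two]
  · rintro ⟨x, z, s⟩ h
    simp only at h
    simp [h, bumpOuter_one]

theorem interp_start (x : Circle) (z : RZ) (s : ℝ) : interp x z s 0 = mul x z := by
  simp [interp, interpA]

theorem interp_end (x : Circle) (z : RZ) (s : ℝ) : interp x z s 3 = mul x (interpEnd x z s) := by
  norm_num [interp, interpC, interpEnd]
  split_ifs <;> simp

theorem interp_left (x : Circle) (z : RZ) (r : ℝ) : interp x z 0 r = mul x z := by
  simp [interp, interpA, interpB, interpC, bumpOuter_zero]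

theorem interp_right (x : Circle) (z : RZ) (r : ℝ) :
    interp x z 4 r = cancel x (clampI (r - 2)) (mul x z) := by
  norm_num [interp, interpA, interpB, interpC, bumpOuter_four]
  split_ifs with h1 h2
  · rw [clampI_of_nonpos (by linarith), cancel_zero]
  · rw [clampI_of_nonpos (by linarith), cancel_zero]
  · rfl

theorem interpEnd_left (x : Circle) (z : RZ) : interpEnd x z 0 = z := by
  simp [interpEnd, bumpOuter_zero]

theorem interpEnd_right (x : Circle) (z : RZ) : interpEnd x z 4 = mul x⁻¹ (mul x z) := by
  norm_num [interpEnd, bumpOuter_four]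

end RZ

/-! ### The closed unit disc and the sphere as the disc with collapsed boundary -/

/-- The closed unit disc. -/
abbrev Disc : Type := Metric.closedBall (0 : ℂ) 1

namespace Disc

theorem norm_le (d : Disc) : ‖(d : ℂ)‖ ≤ 1 := mem_closedBall_zero_iff.1 d.2

/-- The inclusion of the boundary circle. -/
def bdry (x : Circle) : Disc := ⟨(x : ℂ), mem_closedBall_zero_iff.2 (Circle.norm_coe x).le⟩

@[simp] theorem norm_bdry (x : Circle) : ‖((bdry x : Disc) : ℂ)‖ = 1 := Circle.norm_coe x

@[fun_prop] theorem continuous_bdry : Continuous bdry :=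
  Continuous.subtype_mk continuous_subtype_val _

/-- Stretching the disc by the factor `max m 1`, followed by the radial retraction onto the disc. -/
noncomputable def clamp (m : ℝ) (d : Disc) : Disc :=
  ⟨((max m 1 / max 1 (max m 1 * ‖(d : ℂ)‖) : ℝ) : ℂ) * d, by
    rw [mem_closedBall_zero_iff, norm_mul, Complex.norm_real, Real.norm_of_nonneg (by positivity),
      div_mul_eq_mul_div]
    exact div_le_one_of_le₀ (le_max_right _ _) (by positivity)⟩

theorem coe_clamp (m : ℝ) (d : Disc) : (clamp m d : ℂ) =
    ((max m 1 / max 1 (max m 1 * ‖(d : ℂ)‖) : ℝ) : ℂ) * d := rfl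

theorem norm_clamp (m : ℝ) (d : Disc) : ‖(clamp m d : ℂ)‖ = min 1 (max m 1 * ‖(d : ℂ)‖) := by
  rw [coe_clamp, norm_mul, Complex.norm_real, Real.norm_of_nonneg (by positivity),
    div_mul_eq_mul_div]
  rcases le_total 1 (max m 1 * ‖(d : ℂ)‖) with h | h
  · rw [max_eq_right h, min_eq_left h, div_self (by positivity)]
  · rw [max_eq_left h, min_eq_right h, div_one]

@[fun_prop] theorem _root_.Continuous.discClamp {X : Type*} [TopologicalSpace X] {m : X → ℝ}
    {d : X → Disc} (hm : Continuous m) (hd : Continuous d) :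
    Continuous fun a => Disc.clamp (m a) (d a) := by
  refine Continuous.subtype_mk ?_ _
  refine (Complex.continuous_ofReal.comp (Continuous.div (by fun_prop) (by fun_prop) ?_)).mul
    (by fun_prop)
  intro a; positivity

theorem _root_.ContinuousOn.discClamp {X : Type*} [TopologicalSpace X] {m : X → ℝ}
    {d : X → Disc} {s : Set X} (hm : ContinuousOn m s) (hd : ContinuousOn d s) :
    ContinuousOn (fun a => Disc.clamp (m a) (d a)) s :=
  Continuous.comp_continuousOn (g := fun p : ℝ × Disc => Disc.clamp p.1 p.2)
    (f := fun a => (m a, d a)) (by fun_prop) (hm.prodMk hd)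

theorem clamp_of_norm_eq_one (m : ℝ) {d : Disc} (h : ‖(d : ℂ)‖ = 1) : clamp m d = d := by
  apply Subtype.ext
  rw [coe_clamp, h, mul_one, max_eq_right (le_max_right m 1), div_self (by positivity)]
  simp

@[simp] theorem clamp_bdry (m : ℝ) (x : Circle) : clamp m (bdry x) = bdry x :=
  clamp_of_norm_eq_one m (norm_bdry x)

theorem clamp_of_le_one {m : ℝ} (hm : m ≤ 1) (d : Disc) : clamp m d = d := by
  apply Subtype.ext
  rw [coe_clamp, max_eq_right hm, one_mul, max_eq_left d.norm_le]
  simp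

/-- A point retracted to the boundary by the first stretching would also be retracted by the
combined one because `1 ≤ a`, so the factors multiply. -/
theorem clamp_clamp (a m : ℝ) (hm : 1 ≤ m) (ha : 1 ≤ a) (d : Disc) :
    clamp a (clamp m d) = clamp (a * m) d := by
  apply Subtype.ext
  have ham : 1 ≤ a * m := by nlinarith
  rw [coe_clamp a, norm_clamp, coe_clamp, coe_clamp, ← mul_assoc, ← Complex.ofReal_mul,
    max_eq_left hm, max_eq_left ha, max_eq_left ham]
  congr 2
  have hd := norm_nonneg (d : ℂ)
  rcases le_total 1 (m * ‖(d : ℂ)‖) with h | h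
  · have h' : 1 ≤ a * m * ‖(d : ℂ)‖ := by
      rw [mul_assoc]; nlinarith
    rw [min_eq_left h, max_eq_right h, max_eq_right h', mul_one, max_eq_right ha]
    have : ‖(d : ℂ)‖ ≠ 0 := by rintro h0; rw [h0] at h; norm_num at h
    have : a ≠ 0 := by positivity
    have : m ≠ 0 := by positivity
    field_simp
  · rw [min_eq_right h, max_eq_left h, mul_assoc, div_one]
    ring

/-- The point of the circle given by a complex number of norm one. -/
def _root_.Circle.ofNormEqOne (z : ℂ) (h : ‖z‖ = 1) : Circle := ⟨z, mem_sphere_zero_iff_norm.2 h⟩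

/-- The direction of a nonzero point of the disc. -/
noncomputable def dir (d : Disc) : Circle :=
  if h : (d : ℂ) = 0 then 1 else
    Circle.ofNormEqOne ((d : ℂ) / ‖(d : ℂ)‖) (by
      rw [norm_div, Complex.norm_real, norm_norm, div_self (norm_ne_zero_iff.2 h)])

theorem coe_dir {d : Disc} (h : (d : ℂ) ≠ 0) : (dir d : ℂ) = d / ‖(d : ℂ)‖ := by
  rw [dir, dif_neg h]; rfl

@[simp] theorem dir_bdry (x : Circle) : dir (bdry x) = x := by
  apply Circle.ext
  have h : ‖((bdry x : Disc) : ℂ)‖ = 1 := norm_bdry x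
  rw [coe_dir (norm_ne_zero_iff.1 (by rw [h]; norm_num)), h]
  simp [bdry]

theorem bdry_dir {d : Disc} (h : ‖(d : ℂ)‖ = 1) : bdry (dir d) = d := by
  apply Subtype.ext
  change ((dir d : Circle) : ℂ) = d
  rw [coe_dir (norm_ne_zero_iff.1 (by rw [h]; norm_num)), h]
  simp

theorem continuousOn_dir : ContinuousOn dir {d | (d : ℂ) ≠ 0} := by
  rw [continuousOn_iff_continuous_domRestrict]
  have : Continuous fun d : {d : Disc | (d : ℂ) ≠ 0} => ((d : Disc) : ℂ) / ‖((d : Disc) : ℂ)‖ :=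
    Continuous.div (by fun_prop) (by fun_prop) fun d => by
      simpa using d.2
  refine continuous_induced_rng.2 (this.congr fun d => ?_)
  exact (coe_dir d.2).symm

theorem clamp_of_one_le {m : ℝ} {d : Disc} (h : 1 ≤ max m 1 * ‖(d : ℂ)‖) :
    clamp m d = bdry (dir d) := by
  apply Subtype.ext
  have h0 : (d : ℂ) ≠ 0 := by
    rintro h0; rw [h0] at h; norm_num at h
  change _ = ((dir d : Circle) : ℂ)
  rw [coe_clamp, coe_dir h0, max_eq_right h]
  have : ((max m 1 : ℝ) : ℂ) ≠ 0 := Complex.ofReal_ne_zero.2 (by positivity)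
  push_cast at this ⊢
  have := Complex.ofReal_ne_zero.2 (norm_ne_zero_iff.2 h0)
  field_simp

theorem dir_clamp (m : ℝ) (d : Disc) : dir (clamp m d) = dir d := by
  have hpos : 0 < max m 1 / max 1 (max m 1 * ‖(d : ℂ)‖) := by positivity
  by_cases h : (d : ℂ) = 0
  · have : (clamp m d : ℂ) = 0 := by rw [coe_clamp, h, mul_zero]
    rw [dir, dir, dif_pos h, dif_pos this]
  · have : (clamp m d : ℂ) ≠ 0 := by
      rw [coe_clamp]; exact mul_ne_zero (Complex.ofReal_ne_zero.2 hpos.ne') h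
    apply Circle.ext
    rw [coe_dir h, coe_dir this, coe_clamp, norm_mul, Complex.norm_real,
      Real.norm_of_nonneg hpos.le, Complex.ofReal_mul]
    exact mul_div_mul_left _ _ (Complex.ofReal_ne_zero.2 hpos.ne')

end Disc

/-! ### Polar coordinates on the sphere around the antipode of the pole. -/

namespace TwoSphere

/-- The map from the disc to the sphere which collapses the boundary to a pole. -/
noncomputable def ofDisc (d : Disc) : TwoSphere :=
  ⟨!₂[2 * √(1 - ‖(d : ℂ)‖ ^ 2) * (d : ℂ).re, 2 * √(1 - ‖(d : ℂ)‖ ^ 2) * (d : ℂ).im,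
    2 * ‖(d : ℂ)‖ ^ 2 - 1], by
    have h1 := d.norm_le
    have h0 := norm_nonneg (d : ℂ)
    have hs : √(1 - ‖(d : ℂ)‖ ^ 2) ^ 2 = 1 - ‖(d : ℂ)‖ ^ 2 := Real.sq_sqrt (by nlinarith)
    have hn : ‖(d : ℂ)‖ ^ 2 = (d : ℂ).re ^ 2 + (d : ℂ).im ^ 2 := by
      rw [← Complex.normSq_eq_norm_sq, Complex.normSq_apply]; ring
    rw [mem_sphere_zero_iff_norm, EuclideanSpace.norm_eq, Real.sqrt_eq_one]
    simp only [Real.norm_eq_abs, sq_abs, Fin.sum_univ_three]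
    simp only [Matrix.cons_val]
    simp only [mul_pow, hs]
    linear_combination (-4 + 4 * ‖(d : ℂ)‖ ^ 2) * hn⟩

theorem continuous_ofDisc : Continuous ofDisc := by
  refine Continuous.subtype_mk ((PiLp.continuous_toLp 2 _).comp (continuous_pi fun i => ?_)) _
  fin_cases i <;> simp <;> fun_prop

/-- The radial coordinate on the sphere, equal to `1` at the base point. -/
noncomputable def rho (b : TwoSphere) : ℝ := √((1 + (b : EuclideanSpace ℝ (Fin 3)) 2) / 2)

@[fun_prop] theorem continuous_rho : Continuous rho := by
  unfold rho; fun_prop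

@[simp] theorem rho_ofDisc (d : Disc) : rho (ofDisc d) = ‖(d : ℂ)‖ := by
  have : (ofDisc d : EuclideanSpace ℝ (Fin 3)) 2 = 2 * ‖(d : ℂ)‖ ^ 2 - 1 := rfl
  rw [rho, this]
  rw [show (1 + (2 * ‖(d : ℂ)‖ ^ 2 - 1)) / 2 = ‖(d : ℂ)‖ ^ 2 by ring, Real.sqrt_sq (norm_nonneg _)]

theorem coord_sq (b : TwoSphere) : (b : EuclideanSpace ℝ (Fin 3)) 0 ^ 2 +
    (b : EuclideanSpace ℝ (Fin 3)) 1 ^ 2 + (b : EuclideanSpace ℝ (Fin 3)) 2 ^ 2 = 1 := by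
  have := mem_sphere_zero_iff_norm.1 b.2
  rw [EuclideanSpace.norm_eq, Real.sqrt_eq_one] at this
  simpa [Fin.sum_univ_three] using this

theorem ofDisc_surjective : Function.Surjective ofDisc := by
  intro b
  have hb := coord_sq b
  set x := (b : EuclideanSpace ℝ (Fin 3)) 0 with hx
  set y := (b : EuclideanSpace ℝ (Fin 3)) 1 with hy
  set z := (b : EuclideanSpace ℝ (Fin 3)) 2 with hz
  have hz1 : z ≤ 1 := by nlinarith
  have hz2 : -1 ≤ z := by nlinarith
  rcases hz1.eq_or_lt with h1 | h1
  · refine ⟨Disc.bdry 1, Subtype.ext ?_⟩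
    have hx0 : x = 0 := by nlinarith
    have hy0 : y = 0 := by nlinarith
    ext i
    fin_cases i
    · simp [ofDisc, ← hx, hx0]
    · simp [ofDisc, ← hy, hy0]
    · simp [ofDisc, ← hz, h1]; norm_num
  -- From `z = 2‖d‖² - 1` the factor `2√(1 - ‖d‖²)` at the preimage must equal `√(2(1 - z))`;
  -- dividing the first two coordinates by it recovers `d`.
  · set r := √(2 * (1 - z)) with hr
    have hr0 : 0 < r := Real.sqrt_pos.2 (by linarith)
    have hr2 : r ^ 2 = 2 * (1 - z) := Real.sq_sqrt (by linarith)
    have hn : ‖(⟨x / r, y / r⟩ : ℂ)‖ ^ 2 = (1 + z) / 2 := by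
      rw [← Complex.normSq_eq_norm_sq, Complex.normSq_mk]
      field_simp
      rw [hr2]; linear_combination 2 * hb
    have hd : ‖(⟨x / r, y / r⟩ : ℂ)‖ ≤ 1 := by
      have := norm_nonneg (⟨x / r, y / r⟩ : ℂ)
      nlinarith
    have hs : 2 * √(1 - ‖(⟨x / r, y / r⟩ : ℂ)‖ ^ 2) = r := by
      rw [hn, hr, show 2 * (1 - z) = 2 ^ 2 * (1 - (1 + z) / 2) by ring,
        Real.sqrt_mul (by norm_num), Real.sqrt_sq (by norm_num)]
    refine ⟨⟨⟨x / r, y / r⟩, mem_closedBall_zero_iff.2 hd⟩, Subtype.ext ?_⟩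
    ext i
    fin_cases i
    · simp only [ofDisc, hs]; simp [← hx]; field_simp
    · simp only [ofDisc, hs]; simp [← hy]; field_simp
    · simp only [ofDisc, hn]; simp [← hz]; ring

theorem ofDisc_eq_iff {d d' : Disc} :
    ofDisc d = ofDisc d' ↔ d = d' ∨ (‖(d : ℂ)‖ = 1 ∧ ‖(d' : ℂ)‖ = 1) := by
  constructor
  · intro h
    have hn : ‖(d : ℂ)‖ = ‖(d' : ℂ)‖ := by rw [← rho_ofDisc, h, rho_ofDisc]
    rcases d.norm_le.eq_or_lt with h1 | h1
    · exact Or.inr ⟨h1, hn ▸ h1⟩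
    · left
      have hs : 0 < 2 * √(1 - ‖(d : ℂ)‖ ^ 2) := by
        have := norm_nonneg (d : ℂ)
        have : 0 < √(1 - ‖(d : ℂ)‖ ^ 2) := Real.sqrt_pos.2 (by nlinarith)
        positivity
      have e0 : 2 * √(1 - ‖(d : ℂ)‖ ^ 2) * (d : ℂ).re = 2 * √(1 - ‖(d' : ℂ)‖ ^ 2) * (d' : ℂ).re :=
        congrArg (fun b : TwoSphere => (b : EuclideanSpace ℝ (Fin 3)) 0) h
      have e1 : 2 * √(1 - ‖(d : ℂ)‖ ^ 2) * (d : ℂ).im = 2 * √(1 - ‖(d' : ℂ)‖ ^ 2) * (d' : ℂ).im :=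
        congrArg (fun b : TwoSphere => (b : EuclideanSpace ℝ (Fin 3)) 1) h
      rw [← hn] at e0 e1
      exact Subtype.ext (Complex.ext (mul_left_cancel₀ hs.ne' e0) (mul_left_cancel₀ hs.ne' e1))
  · rintro (rfl | ⟨h, h'⟩)
    · rfl
    · refine Subtype.ext ?_
      ext i
      fin_cases i <;> simp [ofDisc, h, h']

/-- The image of the boundary of the disc. -/
noncomputable def pole : TwoSphere := ofDisc (Disc.bdry 1)

theorem ofDisc_of_norm_eq_one {d : Disc} (h : ‖(d : ℂ)‖ = 1) : ofDisc d = pole :=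
  ofDisc_eq_iff.2 (Or.inr ⟨h, Disc.norm_bdry 1⟩)

@[simp] theorem ofDisc_bdry (x : Circle) : ofDisc (Disc.bdry x) = pole :=
  ofDisc_of_norm_eq_one (Disc.norm_bdry x)

@[simp] theorem rho_pole : rho pole = 1 := by rw [pole, rho_ofDisc, Disc.norm_bdry]

/-- A section of `ofDisc`, continuous away from the pole. -/
noncomputable def sec (b : TwoSphere) : Disc := Function.surjInv ofDisc_surjective b

@[simp] theorem ofDisc_sec (b : TwoSphere) : ofDisc (sec b) = b :=
  Function.surjInv_eq ofDisc_surjective b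

@[simp] theorem norm_sec (b : TwoSphere) : ‖(sec b : ℂ)‖ = rho b := by
  rw [← rho_ofDisc, ofDisc_sec]

theorem sec_ofDisc {d : Disc} (h : ‖(d : ℂ)‖ < 1) : sec (ofDisc d) = d :=
  (ofDisc_eq_iff.1 (ofDisc_sec (ofDisc d))).resolve_right fun h' => h.ne h'.2

theorem isQuotientMap_ofDisc : IsQuotientMap ofDisc :=
  IsQuotientMap.of_surjective_continuous ofDisc_surjective continuous_ofDisc

theorem continuousOn_sec : ContinuousOn sec {b | rho b < 1} := by
  have ho : IsOpen {b : TwoSphere | rho b < 1} := isOpen_lt continuous_rho continuous_const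
  refine (isQuotientMap_ofDisc.continuousOn_isOpen_iff ho).2 ?_
  refine continuousOn_id.congr fun d hd => ?_
  exact sec_ofDisc (by simpa using hd)

/-- The direction of a point of the sphere, as seen from the antipode of the pole. -/
noncomputable def dir (b : TwoSphere) : Circle := (sec b).dir

theorem continuousOn_dir : ContinuousOn dir {b | 0 < rho b ∧ rho b < 1} := by
  refine Disc.continuousOn_dir.comp (continuousOn_sec.mono fun b hb => hb.2) fun b hb => ?_
  exact norm_ne_zero_iff.1 (by rw [norm_sec]; exact hb.1.ne')

/-- The self-map of the sphere induced by `Disc.clamp`. -/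
noncomputable def push (m : ℝ) (b : TwoSphere) : TwoSphere := ofDisc ((sec b).clamp m)

-- Over the pole `sec` picks some boundary point, possibly not `d`; this is harmless because
-- `Disc.clamp` fixes the boundary.
@[simp] theorem push_ofDisc (m : ℝ) (d : Disc) : push m (ofDisc d) = ofDisc (d.clamp m) := by
  rcases d.norm_le.eq_or_lt with h | h
  · have h2 : ‖(sec (ofDisc d) : ℂ)‖ = 1 := by simpa using h
    rw [push, Disc.clamp_of_norm_eq_one m h2, ofDisc_sec, Disc.clamp_of_norm_eq_one m h]
  · rw [push, sec_ofDisc h]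

theorem continuous_uncurry_push : Continuous fun p : TwoSphere × ℝ => push p.2 p.1 := by
  refine (isQuotientMap_prodMap_id (Y := ℝ) continuous_ofDisc
    ofDisc_surjective).continuous_iff.2 ?_
  have h2 : Continuous fun p : Disc × ℝ => ofDisc (p.1.clamp p.2) :=
    continuous_ofDisc.comp (by fun_prop)
  exact h2.congr fun p => (push_ofDisc p.2 p.1).symm

@[fun_prop] theorem _root_.Continuous.twoSpherePush {X : Type*} [TopologicalSpace X] {m : X → ℝ}
    {b : X → TwoSphere} (hm : Continuous m) (hb : Continuous b) :
    Continuous fun a => TwoSphere.push (m a) (b a) :=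
  Continuous.comp (g := fun p : TwoSphere × ℝ => TwoSphere.push p.2 p.1)
    (f := fun a => (b a, m a)) continuous_uncurry_push (hb.prodMk hm)

theorem push_of_le_one {m : ℝ} (hm : m ≤ 1) (b : TwoSphere) : push m b = b := by
  rw [push, Disc.clamp_of_le_one hm, ofDisc_sec]

@[simp] theorem push_pole (m : ℝ) : push m pole = pole := by rw [pole, push_ofDisc, Disc.clamp_bdry]

theorem push_push {a m : ℝ} (ha : 1 ≤ a) (hm : 1 ≤ m) (b : TwoSphere) :
    push a (push m b) = push (a * m) b := by
  have h : push m b = ofDisc ((sec b).clamp m) := rfl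
  rw [h, push_ofDisc, Disc.clamp_clamp a m hm ha]; rfl

theorem push_eq_pole {m : ℝ} {b : TwoSphere} (h : 1 ≤ max m 1 * rho b) : push m b = pole := by
  rw [push, Disc.clamp_of_one_le (by simpa using h), ofDisc_bdry]

theorem rho_push (m : ℝ) (b : TwoSphere) : rho (push m b) = min 1 (max m 1 * rho b) := by
  rw [push, rho_ofDisc, Disc.norm_clamp, norm_sec]

end TwoSphere

/-! ### The total space over the sphere with fibre `|Z|` -/

/-- The identifications `(x, z) ∼ (1, x z)` for `x` on the boundary of the disc. -/
def ClutchRel (p p' : Disc × RZ) : Prop :=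
  ∃ (x : Circle) (z : RZ), p = (Disc.bdry x, z) ∧ p' = (Disc.bdry 1, RZ.mul x z)

/-- The space over the sphere obtained by clutching the action of the circle on `|Z|`. -/
def Clutch : Type := Quot ClutchRel

instance : TopologicalSpace Clutch := inferInstanceAs (TopologicalSpace (Quot ClutchRel))

namespace Clutch

/-- The point of the total space with given disc and fibre coordinates. -/
def mk (d : Disc) (z : RZ) : Clutch := Quot.mk _ (d, z)

/-- The fibre over the pole. -/
noncomputable def base (z : RZ) : Clutch := mk (Disc.bdry 1) z

theorem mk_bdry (x : Circle) (z : RZ) : mk (Disc.bdry x) z = base (RZ.mul x z) :=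
  Quot.sound ⟨x, z, rfl, rfl⟩

theorem ind {P : Clutch → Prop} (h : ∀ d z, P (mk d z)) (e : Clutch) : P e := by
  induction e using Quot.ind with
  | mk p => exact h p.1 p.2

/-- Maps out of the total space. -/
def lift {α : Type*} (g : Disc → RZ → α)
    (h : ∀ x z, g (Disc.bdry x) z = g (Disc.bdry 1) (RZ.mul x z)) : Clutch → α :=
  Quot.lift (fun p => g p.1 p.2) (by rintro _ _ ⟨x, z, rfl, rfl⟩; exact h x z)

theorem isQuotientMap_mk : IsQuotientMap fun p : Disc × RZ => mk p.1 p.2 :=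
  isQuotientMap_quot_mk (r := ClutchRel)

theorem continuous_uncurry_mk : Continuous fun p : Disc × RZ => mk p.1 p.2 :=
  isQuotientMap_mk.continuous

@[fun_prop] theorem _root_.Continuous.clutchMk {X : Type*} [TopologicalSpace X] {d : X → Disc}
    {z : X → RZ} (hd : Continuous d) (hz : Continuous z) :
    Continuous fun a => Clutch.mk (d a) (z a) :=
  Continuous.comp (g := fun p : Disc × RZ => Clutch.mk p.1 p.2)
    (f := fun a => (d a, z a)) continuous_uncurry_mk (hd.prodMk hz)

theorem _root_.ContinuousOn.clutchMk {X : Type*} [TopologicalSpace X] {d : X → Disc}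
    {z : X → RZ} {s : Set X} (hd : ContinuousOn d s) (hz : ContinuousOn z s) :
    ContinuousOn (fun a => Clutch.mk (d a) (z a)) s :=
  Continuous.comp_continuousOn (g := fun p : Disc × RZ => Clutch.mk p.1 p.2)
    (f := fun a => (d a, z a)) continuous_uncurry_mk (hd.prodMk hz)

@[fun_prop] theorem continuous_base : Continuous base := by unfold base; fun_prop

/-- The projection to the sphere. -/
noncomputable def proj : Clutch → TwoSphere :=
  lift (fun d _ => TwoSphere.ofDisc d) (by simp)

@[simp] theorem proj_mk (d : Disc) (z : RZ) : proj (mk d z) = TwoSphere.ofDisc d := rfl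

@[simp] theorem proj_base (z : RZ) : proj (base z) = TwoSphere.pole := rfl

@[fun_prop] theorem continuous_proj : Continuous proj :=
  isQuotientMap_mk.continuous_iff.2 (TwoSphere.continuous_ofDisc.comp continuous_fst)

/-- The map of the total space covering `TwoSphere.push`. -/
noncomputable def push (m : ℝ) : Clutch → Clutch :=
  lift (fun d z => mk (d.clamp m) z) (by intro x z; simp [mk_bdry])

@[simp] theorem push_mk (m : ℝ) (d : Disc) (z : RZ) : push m (mk d z) = mk (d.clamp m) z := rfl

@[simp] theorem push_base (m : ℝ) (z : RZ) : push m (base z) = base z := by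
  rw [base, push_mk, Disc.clamp_bdry]

theorem proj_push (m : ℝ) (e : Clutch) : proj (push m e) = TwoSphere.push m (proj e) := by
  induction e using ind with
  | h d z => simp

theorem continuous_uncurry_push : Continuous fun p : Clutch × ℝ => push p.2 p.1 := by
  refine isQuotientMap_mk.continuous_lift_prod_left ?_
  exact (by fun_prop : Continuous fun p : (Disc × RZ) × ℝ => mk (p.1.1.clamp p.2) p.1.2)

@[fun_prop] theorem _root_.Continuous.clutchPush {X : Type*} [TopologicalSpace X] {m : X → ℝ}
    {e : X → Clutch} (hm : Continuous m) (he : Continuous e) :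
    Continuous fun a => Clutch.push (m a) (e a) :=
  Continuous.comp (g := fun p : Clutch × ℝ => Clutch.push p.2 p.1)
    (f := fun a => (e a, m a)) continuous_uncurry_push (he.prodMk hm)

theorem push_of_le_one {m : ℝ} (hm : m ≤ 1) (e : Clutch) : push m e = e := by
  induction e using ind with
  | h d z => rw [push_mk, Disc.clamp_of_le_one hm]

open Classical in
/-- The fibre coordinate away from the pole. -/
noncomputable def inner : Clutch → RZ :=
  lift (fun d z => if ‖(d : ℂ)‖ < 1 then z else RZ.mul d.dir z) (by intro x z; simp)

open Classical in
/-- The fibre coordinate near the pole. -/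
noncomputable def outer : Clutch → RZ :=
  lift (fun d z => if (d : ℂ) = 0 then z else RZ.mul d.dir z) (by
    intro x z
    have h (x : Circle) : ((Disc.bdry x : Disc) : ℂ) ≠ 0 :=
      norm_ne_zero_iff.1 (by rw [Disc.norm_bdry]; norm_num)
    simp [h])

theorem inner_mk {d : Disc} (h : ‖(d : ℂ)‖ < 1) (z : RZ) : inner (mk d z) = z := if_pos h

theorem outer_mk {d : Disc} (h : (d : ℂ) ≠ 0) (z : RZ) : outer (mk d z) = RZ.mul d.dir z := if_neg h

@[simp] theorem outer_base (z : RZ) : outer (base z) = z := by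
  rw [base, outer_mk (norm_ne_zero_iff.1 (by rw [Disc.norm_bdry]; norm_num)), Disc.dir_bdry,
    RZ.mul_one]

theorem continuousOn_inner : ContinuousOn inner {e | (proj e).rho < 1} := by
  have ho : IsOpen {e : Clutch | (proj e).rho < 1} :=
    isOpen_lt (TwoSphere.continuous_rho.comp continuous_proj) continuous_const
  refine (isQuotientMap_mk.continuousOn_isOpen_iff ho).2 ?_
  refine continuous_snd.continuousOn.congr fun p hp => ?_
  exact inner_mk (by simpa using hp) _

theorem continuousOn_outer : ContinuousOn outer {e | 0 < (proj e).rho} := by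
  have ho : IsOpen {e : Clutch | 0 < (proj e).rho} :=
    isOpen_lt continuous_const (TwoSphere.continuous_rho.comp continuous_proj)
  refine (isQuotientMap_mk.continuousOn_isOpen_iff ho).2 ?_
  have hne (p : Disc × RZ) (hp : p ∈ (fun p : Disc × RZ => mk p.1 p.2) ⁻¹'
      {e : Clutch | 0 < (proj e).rho}) : (p.1 : ℂ) ≠ 0 := by
    simpa using hp
  refine (ContinuousOn.rzMul (Disc.continuousOn_dir.comp continuous_fst.continuousOn hne)
    continuous_snd.continuousOn).congr fun p hp => ?_
  exact outer_mk (hne p hp) _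

theorem eq_base {e : Clutch} (h : (proj e).rho = 1) : e = base (outer e) := by
  induction e using ind with
  | h d z =>
    rw [proj_mk, TwoSphere.rho_ofDisc] at h
    conv_lhs => rw [← Disc.bdry_dir h, mk_bdry]
    rw [outer_mk (norm_ne_zero_iff.1 (by rw [h]; norm_num))]

theorem eq_mk {e : Clutch} (h : (proj e).rho < 1) : e = mk (proj e).sec (inner e) := by
  induction e using ind with
  | h d z =>
    rw [proj_mk, TwoSphere.rho_ofDisc] at h
    rw [proj_mk, TwoSphere.sec_ofDisc h, inner_mk h]

/-- This is the transition between the two fibre coordinates. Multiplication by the direction is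
only a homotopy equivalence, which is the source of all later difficulties. -/
theorem outer_eq {e : Clutch} (h0 : 0 < (proj e).rho) (h : (proj e).rho < 1) :
    outer e = RZ.mul (proj e).dir (inner e) := by
  induction e using ind with
  | h d z =>
    rw [proj_mk, TwoSphere.rho_ofDisc] at h h0
    rw [proj_mk, TwoSphere.dir, TwoSphere.sec_ofDisc h, inner_mk h, outer_mk (norm_pos_iff.1 h0)]

theorem push_eq_base {m : ℝ} {e : Clutch} (h : 1 ≤ max m 1 * (proj e).rho) :
    push m e = base (outer e) := by
  induction e using ind with
  | h d z =>
    rw [proj_mk, TwoSphere.rho_ofDisc] at h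
    have h0 : (d : ℂ) ≠ 0 := by rintro h0; rw [h0] at h; norm_num at h
    rw [push_mk, Disc.clamp_of_one_le h, mk_bdry, outer_mk h0]

end Clutch

/-! ### The total space is contractible -/

namespace Disc

theorem trunc_aux (d : Disc) (a : ℝ) :
    1 - ((max a 0 / max (max a 0) ‖1 - (d : ℂ)‖ : ℝ) : ℂ) * (1 - d) ∈
      Metric.closedBall (0 : ℂ) 1 := by
  rw [mem_closedBall_zero_iff]
  set s := max a 0 / max (max a 0) ‖1 - (d : ℂ)‖ with hs
  have h0 : 0 ≤ s := by positivity
  have h1 : s ≤ 1 := div_le_one_of_le₀ (le_max_left _ _) (by positivity)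
  -- A convex combination of `1` and `d` stays in the disc.
  have e : 1 - (s : ℂ) * (1 - d) = ((1 - s : ℝ) : ℂ) + (s : ℂ) * d := by push_cast; ring
  rw [e]
  refine (norm_add_le _ _).trans ?_
  rw [norm_mul, Complex.norm_real, Complex.norm_real, Real.norm_of_nonneg h0,
    Real.norm_of_nonneg (by linarith)]
  nlinarith [d.norm_le]

/-- Radial contraction of the disc to the boundary point `1`, truncating the distance to `1` at
the value `a`. -/
noncomputable def trunc (d : Disc) (a : ℝ) : Disc := ⟨_, trunc_aux d a⟩

/-- The scaling factor has a vanishing denominator only when `a ≤ 0` and `d = 1`. It is always at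
most `1`, so near such a point the product is bounded by `‖1 - d‖`, which tends to `0`. -/
theorem continuous_trunc : Continuous fun p : Disc × ℝ => trunc p.1 p.2 := by
  refine Continuous.subtype_mk (continuous_const.sub ?_) _
  rw [continuous_iff_continuousAt]
  rintro ⟨d, a⟩
  by_cases h : max (max a 0) ‖1 - (d : ℂ)‖ = 0
  · have ha : max a 0 = 0 := le_antisymm ((le_max_left _ _).trans h.le) (le_max_right _ _)
    have hd : 1 - (d : ℂ) = 0 := norm_le_zero_iff.1 ((le_max_right _ _).trans h.le)
    have hval : ((max a 0 / max (max a 0) ‖1 - (d : ℂ)‖ : ℝ) : ℂ) * (1 - d) = 0 := by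
      rw [hd, mul_zero]
    rw [ContinuousAt, hval]
    have hlim : Filter.Tendsto (fun p : Disc × ℝ => ‖1 - (p.1 : ℂ)‖) (𝓝 (d, a)) (𝓝 0) := by
      have : Continuous fun p : Disc × ℝ => ‖1 - (p.1 : ℂ)‖ := by fun_prop
      simpa [hd] using this.tendsto (d, a)
    refine squeeze_zero_norm (fun p => ?_) hlim
    rw [norm_mul, Complex.norm_real, Real.norm_of_nonneg (by positivity)]
    exact mul_le_of_le_one_left (norm_nonneg _)
      (div_le_one_of_le₀ (le_max_left _ _) (by positivity))
  · refine ContinuousAt.mul (Complex.continuous_ofReal.continuousAt.comp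
      (ContinuousAt.div (by fun_prop) (by fun_prop) h)) (by fun_prop)

@[fun_prop] theorem _root_.Continuous.discTrunc {X : Type*} [TopologicalSpace X] {d : X → Disc}
    {a : X → ℝ} (hd : Continuous d) (ha : Continuous a) :
    Continuous fun x => Disc.trunc (d x) (a x) :=
  Continuous.comp (g := fun p : Disc × ℝ => Disc.trunc p.1 p.2)
    (f := fun x => (d x, a x)) continuous_trunc (hd.prodMk ha)

theorem trunc_of_le {d : Disc} {a : ℝ} (h : ‖1 - (d : ℂ)‖ ≤ a) : trunc d a = d := by
  apply Subtype.ext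
  change 1 - ((max a 0 / max (max a 0) ‖1 - (d : ℂ)‖ : ℝ) : ℂ) * (1 - d) = d
  have ha : 0 ≤ a := (norm_nonneg _).trans h
  rw [max_eq_left ha, max_eq_left h]
  rcases ha.eq_or_lt with rfl | ha
  · have : 1 - (d : ℂ) = 0 := norm_le_zero_iff.1 h
    rw [this, mul_zero, sub_zero]
    linear_combination this
  · rw [div_self ha.ne']; simp

@[simp] theorem trunc_zero (d : Disc) : trunc d 0 = bdry 1 := by
  apply Subtype.ext
  change 1 - ((max (0 : ℝ) 0 / max (max (0 : ℝ) 0) ‖1 - (d : ℂ)‖ : ℝ) : ℂ) * (1 - d) =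
    ((1 : Circle) : ℂ)
  simp

@[simp] theorem trunc_bdry_one (a : ℝ) : trunc (bdry 1) a = bdry 1 := by
  apply Subtype.ext
  change 1 - ((_ : ℝ) : ℂ) * (1 - ((1 : Circle) : ℂ)) = ((1 : Circle) : ℂ)
  simp

/-- The distance of a point of the disc to the boundary point `1`. -/
noncomputable def dist1 (d : Disc) : ℝ := ‖1 - (d : ℂ)‖

@[fun_prop] theorem continuous_dist1 : Continuous dist1 := by unfold dist1; fun_prop

theorem dist1_nonneg (d : Disc) : 0 ≤ dist1 d := norm_nonneg _

@[simp] theorem dist1_bdry_one : dist1 (bdry 1) = 0 := by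
  change ‖1 - ((1 : Circle) : ℂ)‖ = 0
  simp

end Disc

/-! ### Mass and truncation of words. -/

namespace RZ

/-- The empty word. -/
def nil : RZ := mk (n := 0) Fin.elim0

theorem mk_zero (u : Fin 0 → I) : mk u = nil := congrArg mk (Subsingleton.elim _ _)

/-- The sum of the distances of the letters of a word to the base point. -/
noncomputable def mass : RZ → ℝ :=
  lift (fun n u => ∑ i : Fin n, (Disc.bdry (circleExp (u i))).dist1) (by
    intro n ε i u
    rw [Fin.sum_univ_succAbove _ i]
    cases ε <;> simp [PrecubicalSet.coface])

theorem mass_mk {n : ℕ} (u : Fin n → I) :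
    mass (mk u) = ∑ i : Fin n, (Disc.bdry (circleExp (u i))).dist1 := rfl

theorem mass_mk_succ {n : ℕ} (u : Fin (n + 1) → I) :
    mass (mk u) = (Disc.bdry (circleExp (u 0))).dist1 + mass (mk (Fin.tail u)) := by
  rw [mass_mk, Fin.sum_univ_succ]; rfl

theorem mass_nonneg (z : RZ) : 0 ≤ mass z := by
  induction z using ind with
  | h n u =>
    rw [mass_mk]
    exact Finset.sum_nonneg fun i _ => Disc.dist1_nonneg _

theorem mass_mul (x : Circle) (z : RZ) : mass (mul x z) = (Disc.bdry x).dist1 + mass z := by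
  obtain ⟨t, rfl⟩ := circleExp_surjective x
  induction z using ind with
  | h n u =>
    rw [mul_circleExp, cons_mk, mass_mk_succ]
    simp

@[simp] theorem mass_nil : mass nil = 0 := by simp [nil, mass_mk]

@[fun_prop] theorem continuous_circleExp' : Continuous circleExp := continuous_circleExp

@[fun_prop] theorem continuous_mass : Continuous mass :=
  continuous_iff.2 fun n => by simp only [mass_mk]; fun_prop

/-- Truncating a word from the front to a word of mass at most `R`, with a truncated first letter
in the disc. -/
noncomputable def truncWord : (n : ℕ) → (Fin n → I) → ℝ → Clutch
  | 0, _, _ => Clutch.base nil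
  | n + 1, u, R =>
    if mass (mk (Fin.tail u)) ≤ R then
      Clutch.mk (Disc.trunc (Disc.bdry (circleExp (u 0))) (R - mass (mk (Fin.tail u))))
        (mk (Fin.tail u))
    else truncWord n (Fin.tail u) R

theorem truncWord_of_le {n : ℕ} (u : Fin n → I) {R : ℝ} (h : mass (mk u) ≤ R) :
    truncWord n u R = Clutch.base (mk u) := by
  cases n with
  | zero => rw [mk_zero]; rfl
  | succ n =>
    rw [mass_mk_succ] at h
    have := Disc.dist1_nonneg (Disc.bdry (circleExp (u 0)))
    rw [truncWord, if_pos (by linarith), Disc.trunc_of_le (by unfold Disc.dist1 at h; linarith),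
      Clutch.mk_bdry, mul_circleExp, cons_mk]
    congr 2
    exact Fin.cons_self_tail u

/-- The branches meet where the tail has mass exactly `R`: the truncated first letter has then
reached the base point, and the tail is kept whole. -/
theorem continuous_truncWord (n : ℕ) :
    Continuous fun p : (Fin n → I) × ℝ => truncWord n p.1 p.2 := by
  induction n with
  | zero => exact continuous_const
  | succ n ih =>
    have ht : Continuous fun p : (Fin (n + 1) → I) × ℝ => (Fin.tail p.1 : Fin n → I) :=
      continuous_pi fun i => by unfold Fin.tail; fun_prop
    have hm := (continuous_mk n).comp ht
    have hM := continuous_mass.comp hm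
    unfold truncWord
    refine Continuous.if_le (Continuous.clutchMk (Continuous.discTrunc (by fun_prop)
      (continuous_snd.sub hM)) hm) (ih.comp (ht.prodMk continuous_snd)) hM continuous_snd ?_
    rintro ⟨u, R⟩ h
    simp only at h
    simp only [← h, sub_self, Disc.trunc_zero]
    exact (truncWord_of_le _ le_rfl).symm

/-- A base-point letter has mass zero, so deleting it changes no comparison with `R`. As first
letter it is fixed by `Disc.trunc`, and either the tail is kept whole or the recursion passes on to
it. -/
theorem truncWord_coface {n : ℕ} (ε : Bool) (i : Fin (n + 1)) (u : Fin n → I) (R : ℝ) :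
    truncWord (n + 1) (PrecubicalSet.coface ε i u) R = truncWord n u R := by
  induction n with
  | zero =>
    obtain rfl : i = 0 := Fin.fin_one_eq_zero i
    have h0 : circleExp (PrecubicalSet.coface ε 0 u 0) = 1 := by
      cases ε <;> simp [PrecubicalSet.coface]
    simp only [truncWord]
    rw [h0, mk_zero]
    simp only [Disc.trunc_bdry_one]
    split_ifs <;> rfl
  | succ n ih =>
    induction i using Fin.cases with
    | zero =>
      have h0 : circleExp (PrecubicalSet.coface ε 0 u 0) = 1 := by
        cases ε <;> simp [PrecubicalSet.coface]
      have ht : Fin.tail (PrecubicalSet.coface ε 0 u) = u := by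
        simp [PrecubicalSet.coface]
      rw [truncWord, h0, ht, Disc.trunc_bdry_one]
      split_ifs with h
      · exact (truncWord_of_le u h).symm
      · rfl
    | succ i =>
      have hc : PrecubicalSet.coface ε i.succ u =
          Fin.cons (α := fun _ : Fin (n + 2) => I) (u 0)
            (PrecubicalSet.coface ε i (Fin.tail u)) := by
        conv_lhs => rw [← Fin.cons_self_tail u]
        rw [PrecubicalSet.coface, Fin.insertNth_succ_cons]; rfl
      rw [truncWord, hc, Fin.cons_zero, Fin.tail_cons, mk_coface, ih, truncWord]

/-- Truncating an element of `|Z|`. -/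
noncomputable def trunc (z : RZ) (R : ℝ) : Clutch :=
  lift (fun n u => truncWord n u R) (fun _ ε i u => truncWord_coface ε i u R) z

theorem trunc_of_le {z : RZ} {R : ℝ} (h : mass z ≤ R) : trunc z R = Clutch.base z := by
  induction z using ind with
  | h n u => exact truncWord_of_le u h

/-- A first letter is truncated in the same way as a disc coordinate on the boundary; hence
`Clutch.trunc` respects `(x, z) ∼ (1, x z)`. -/
theorem trunc_mul (x : Circle) (z : RZ) (R : ℝ) : trunc (mul x z) R =
    if mass z ≤ R then Clutch.mk (Disc.trunc (Disc.bdry x) (R - mass z)) z else trunc z R := by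
  obtain ⟨t, rfl⟩ := circleExp_surjective x
  induction z using ind with
  | h n u =>
    rw [mul_circleExp, cons_mk]
    rfl

theorem trunc_zero (z : RZ) : trunc z 0 = Clutch.base nil := by
  induction z using ind with
  | h n u =>
    induction n with
    | zero => rfl
    | succ n ih =>
      change truncWord (n + 1) u 0 = _
      rw [truncWord]
      split_ifs with h
      · have h0 : mass (mk (Fin.tail u)) = 0 := le_antisymm h (mass_nonneg _)
        rw [h0, sub_zero, Disc.trunc_zero, ← ih (Fin.tail u)]
        exact (trunc_of_le h).symm
      · exact ih (Fin.tail u)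

theorem continuous_uncurry_trunc : Continuous fun p : RZ × ℝ => trunc p.1 p.2 :=
  continuous_prod_iff.2 continuous_truncWord

end RZ

/-! ### The contraction of the total space. -/

namespace Clutch

/-- Truncating a point of the total space to total mass at most `R`. -/
noncomputable def trunc (e : Clutch) (R : ℝ) : Clutch :=
  lift (fun d z => if RZ.mass z ≤ R then mk (d.trunc (R - RZ.mass z)) z else RZ.trunc z R) (by
    intro x z
    rw [RZ.trunc_mul, Disc.trunc_bdry_one]
    split_ifs with h1 h2 h2
    · rw [RZ.mass_mul] at h2
      rw [Disc.trunc_of_le (by unfold Disc.dist1 at h2; linarith), mk_bdry, base]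
    · rfl
    · rw [RZ.mass_mul] at h2
      linarith [Disc.dist1_nonneg (Disc.bdry x)]
    · rfl) e

theorem trunc_mk (d : Disc) (z : RZ) (R : ℝ) : trunc (mk d z) R =
    if RZ.mass z ≤ R then mk (d.trunc (R - RZ.mass z)) z else RZ.trunc z R := rfl

theorem continuous_uncurry_trunc : Continuous fun p : Clutch × ℝ => trunc p.1 p.2 := by
  refine isQuotientMap_mk.continuous_lift_prod_left ?_
  have : Continuous fun p : (Disc × RZ) × ℝ => if RZ.mass p.1.2 ≤ p.2 then
      mk (p.1.1.trunc (p.2 - RZ.mass p.1.2)) p.1.2 else RZ.trunc p.1.2 p.2 := by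
    refine Continuous.if_le (by fun_prop)
      (RZ.continuous_uncurry_trunc.comp (by fun_prop :
        Continuous fun p : (Disc × RZ) × ℝ => (p.1.2, p.2))) (by fun_prop) (by fun_prop) ?_
    rintro ⟨⟨d, z⟩, R⟩ h
    simp only at h
    simp only [← h, sub_self, Disc.trunc_zero]
    exact (RZ.trunc_of_le le_rfl).symm
  exact this

/-- The total mass of a point of the total space. -/
noncomputable def mass : Clutch → ℝ :=
  lift (fun d z => d.dist1 + RZ.mass z) (by intro x z; simp [RZ.mass_mul])

theorem continuous_mass : Continuous mass :=
  isQuotientMap_mk.continuous_iff.2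
    (by fun_prop : Continuous fun p : Disc × RZ => p.1.dist1 + RZ.mass p.2)

/-- The contraction of the total space. -/
noncomputable def contract (s : ℝ) (e : Clutch) : Clutch := trunc e ((1 - s) * mass e)

@[fun_prop] theorem _root_.Continuous.clutchContract {X : Type*} [TopologicalSpace X] {s : X → ℝ}
    {e : X → Clutch} (hs : Continuous s) (he : Continuous e) :
    Continuous fun a => Clutch.contract (s a) (e a) :=
  Continuous.comp (g := fun p : Clutch × ℝ => Clutch.trunc p.1 p.2)
    (f := fun a => (e a, (1 - s a) * Clutch.mass (e a))) continuous_uncurry_trunc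
    (he.prodMk ((continuous_const.sub hs).mul (continuous_mass.comp he)))

theorem contract_zero (e : Clutch) : contract 0 e = e := by
  induction e using ind with
  | h d z =>
    have hm : mass (mk d z) = d.dist1 + RZ.mass z := rfl
    have := d.dist1_nonneg
    rw [contract, hm, sub_zero, one_mul, trunc_mk, if_pos (by linarith),
      Disc.trunc_of_le (by unfold Disc.dist1; linarith)]

theorem contract_one (e : Clutch) : contract 1 e = base RZ.nil := by
  rw [contract, sub_self, zero_mul]
  induction e using ind with
  | h d z =>
    rw [trunc_mk]
    split_ifs with h
    · have h0 : RZ.mass z = 0 := le_antisymm h (RZ.mass_nonneg _)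
      rw [h0, sub_zero, Disc.trunc_zero, ← RZ.trunc_zero z, RZ.trunc_of_le h]
      rfl
    · exact RZ.trunc_zero z

/-- The mass of this point is zero, so the truncation level is zero at all times. A contraction
fixing its end point is needed for the deformation to keep loops loops in `HoFiber.equivLoop`. -/
theorem contract_base_nil (s : ℝ) : contract s (base RZ.nil) = base RZ.nil := by
  have hm : mass (base RZ.nil) = 0 := by
    change Disc.dist1 _ + RZ.mass RZ.nil = 0
    simp
  rw [contract, hm, mul_zero]
  have := contract_one (base RZ.nil)
  rwa [contract, hm, mul_zero] at this

end Clutch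

/-! ### The homotopy fibre of the total space over the pole -/

/-- The homotopy fibre of `Clutch.proj` over the pole: pairs of a point of the total space and a
path in the sphere from its projection to the pole. -/
abbrev HoFiber : Type :=
  {p : Clutch × C(I, TwoSphere) // p.2 0 = p.1.proj ∧ p.2 1 = TwoSphere.pole}

namespace HoFiber

/-- The first half of the path in `contract`. -/
noncomputable def contractPath (s : I) (y : HoFiber) (t : I) : TwoSphere :=
  if (t : ℝ) ≤ s / 2 then (y.1.1.contract (s - 2 * t)).proj
  else y.1.2 (clampI ((t - s / 2) / (1 - s / 2)))

/-- The starting point of a path follows the contraction if the projected track of the contraction,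
run backwards, is put in front. The track occupies `[0, s/2]` and the old path is squeezed into
`[s/2, 1]`. -/
theorem continuous_contractPath :
    Continuous fun p : (I × HoFiber) × I => contractPath p.1.1 p.1.2 p.2 := by
  unfold contractPath
  refine Continuous.if_le (by fun_prop) ?_ (by fun_prop) (by fun_prop) ?_
  · refine Continuous.eval (by fun_prop) (continuous_clampI.comp
      (Continuous.div (by fun_prop) (by fun_prop) ?_))
    rintro ⟨⟨s, y⟩, t⟩
    have := s.2.2
    simp only
    linarith
  · rintro ⟨⟨s, y⟩, t⟩ h
    simp only at h
    simp only [h, sub_self, zero_div, clampI_zero, y.2.1]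
    rw [show (s : ℝ) - 2 * (s / 2) = 0 by ring, Clutch.contract_zero]

/-- Deformation of the homotopy fibre into the fibre over the contraction point. -/
noncomputable def contract (s : I) (y : HoFiber) : HoFiber :=
  ⟨(y.1.1.contract s, ⟨contractPath s y, continuous_contractPath.comp
    (by fun_prop : Continuous fun t : I => ((s, y), t))⟩), by
    constructor
    · change contractPath s y 0 = _
      have := s.2.1
      rw [contractPath, if_pos (by simp; linarith)]
      simp
    · change contractPath s y 1 = _
      have := s.2.2
      rw [contractPath, if_neg (by simp; linarith), Set.Icc.coe_one,
        div_self (by linarith), clampI_one, y.2.2]⟩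

theorem continuous_uncurry_contract :
    Continuous fun p : I × HoFiber => contract p.1 p.2 := by
  refine Continuous.subtype_mk (Continuous.prodMk (by fun_prop) ?_) _
  exact ContinuousMap.continuous_of_continuous_uncurry _ continuous_contractPath

theorem contract_zero (y : HoFiber) : contract 0 y = y := by
  refine Subtype.ext (Prod.ext (Clutch.contract_zero _) (ContinuousMap.ext fun t => ?_))
  change contractPath 0 y t = _
  rw [contractPath]
  simp only [Set.Icc.coe_zero, zero_div, sub_zero, div_one, clampI_coe, zero_sub]
  split_ifs with h
  · have h0 : t = 0 := le_antisymm h t.2.1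
    rw [h0, y.2.1]
    simp [Clutch.contract_zero]
  · rfl

/-- A loop of the sphere from a point of the homotopy fibre lying over the pole. -/
def toPath (y : HoFiber) (h : y.1.1.proj = TwoSphere.pole) :
    Path TwoSphere.pole TwoSphere.pole where
  toContinuousMap := y.1.2
  source' := y.2.1.trans h
  target' := y.2.2

theorem continuous_toPath {X : Type*} [TopologicalSpace X] {f : X → HoFiber} (hf : Continuous f)
    (h : ∀ x, (f x).1.1.proj = TwoSphere.pole) : Continuous fun x => toPath (f x) (h x) :=
  continuous_induced_rng.2 (by
    change Continuous fun x => (f x).1.2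
    fun_prop)

/-- The inclusion of the loop space. -/
noncomputable def ofPath : C(Path TwoSphere.pole TwoSphere.pole, HoFiber) where
  toFun ω := ⟨(Clutch.base RZ.nil, ω), by simp⟩
  continuous_toFun := Continuous.subtype_mk (continuous_const.prodMk continuous_induced_dom)
    fun ω => by simp

theorem contract_one_proj (y : HoFiber) : (contract 1 y).1.1.proj = TwoSphere.pole := by
  change (Clutch.contract (1 : I) y.1.1).proj = _
  rw [Set.Icc.coe_one, Clutch.contract_one]; rfl

theorem contract_ofPath_proj (s : I) (ω : Path TwoSphere.pole TwoSphere.pole) :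
    (contract s (ofPath ω)).1.1.proj = TwoSphere.pole := by
  have h : (contract s (ofPath ω)).1.1 = Clutch.contract s (Clutch.base RZ.nil) := rfl
  rw [h, Clutch.contract_base_nil]; rfl

/-- As the total space is contractible, its homotopy fibre is equivalent to the loop space. -/
noncomputable def equivLoop : HoFiber ≃ₕ Path TwoSphere.pole TwoSphere.pole where
  toFun := ⟨fun y => toPath (contract 1 y) (contract_one_proj y), continuous_toPath
    (continuous_uncurry_contract.comp (by fun_prop : Continuous fun y : HoFiber => ((1 : I), y))) _⟩
  invFun := ofPath
  left_inv := ContinuousMap.Homotopic.symm ⟨{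
    toFun := fun p => contract p.1 p.2
    continuous_toFun := continuous_uncurry_contract
    map_zero_left := contract_zero
    map_one_left := fun y => Subtype.ext (Prod.ext (by
      have h : (contract 1 y).1.1 = Clutch.contract (1 : I) y.1.1 := rfl
      rw [h, Set.Icc.coe_one, Clutch.contract_one]; rfl) rfl) }⟩
  right_inv := ContinuousMap.Homotopic.symm ⟨{
    toFun := fun p => toPath (contract p.1 (ofPath p.2)) (contract_ofPath_proj p.1 p.2)
    continuous_toFun := continuous_toPath (continuous_uncurry_contract.comp
      (continuous_fst.prodMk (ofPath.continuous.comp continuous_snd))) _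
    map_zero_left := fun ω => by
      have h := contract_zero (ofPath ω)
      refine Path.ext (funext fun t => ?_)
      change (contract 0 (ofPath ω)).1.2 t = _
      rw [h]; rfl
    map_one_left := fun ω => rfl }⟩

/-- The point of the homotopy fibre given by a point of the total space over the point
`push m (γ t)`. -/
noncomputable def ofPush (e : Clutch) (γ : C(I, TwoSphere)) (t m : ℝ)
    (h : TwoSphere.push m (γ (clampI t)) = e.proj) (ht : 0 ≤ t) (hγ : γ 1 = TwoSphere.pole) :
    HoFiber :=
  ⟨(e, ⟨fun u => TwoSphere.push m (γ (clampI (t + u))), by fun_prop⟩), by simpa using h, by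
    change TwoSphere.push m (γ (clampI (t + (1 : I)))) = _
    rw [clampI_of_one_le (by simpa using ht), hγ, TwoSphere.push_pole]⟩

theorem continuous_ofPush {X : Type*} [TopologicalSpace X] {e : X → Clutch}
    {γ : X → C(I, TwoSphere)} {t m : X → ℝ} (he : Continuous e) (hγ : Continuous γ)
    (ht : Continuous t) (hm : Continuous m)
    (h1 : ∀ x, TwoSphere.push (m x) (γ x (clampI (t x))) = (e x).proj) (h2 : ∀ x, 0 ≤ t x)
    (h3 : ∀ x, γ x 1 = TwoSphere.pole) :
    Continuous fun x => ofPush (e x) (γ x) (t x) (m x) (h1 x) (h2 x) (h3 x) := by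
  refine Continuous.subtype_mk (he.prodMk ?_) _
  refine ContinuousMap.continuous_of_continuous_uncurry _ ?_
  change Continuous fun p : X × I => TwoSphere.push (m p.1) (γ p.1 (clampI (t p.1 + p.2)))
  fun_prop

/-- The inclusion of the fibre. -/
noncomputable def ofBase : C(RZ, HoFiber) where
  toFun z := ⟨(Clutch.base z, ContinuousMap.const I TwoSphere.pole), by simp⟩
  continuous_toFun := Continuous.subtype_mk
    (Clutch.continuous_base.prodMk continuous_const)
    fun z => by simp

theorem ofPush_eq_ofBase {e : Clutch} {γ : C(I, TwoSphere)} {t m : ℝ} {h ht hγ}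
    (h1 : 1 ≤ t) : ofPush e γ t m h ht hγ = ofBase e.outer := by
  have hp : e.proj = TwoSphere.pole := by
    rw [← h, clampI_of_one_le h1, hγ, TwoSphere.push_pole]
  have he : e = Clutch.base e.outer := Clutch.eq_base (by rw [hp, TwoSphere.rho_pole])
  refine Subtype.ext (Prod.ext he ?_)
  refine ContinuousMap.ext fun u => ?_
  change TwoSphere.push m (γ (clampI (t + u))) = TwoSphere.pole
  rw [clampI_of_one_le (by linarith [u.2.1]), hγ, TwoSphere.push_pole]

end HoFiber

/-! ### Infinite concatenation of homotopies -/

section Limit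

variable {X Y : Type*} [TopologicalSpace X] [TopologicalSpace Y] {f : ℕ → C(X, Y)} {S : ℕ → Set X}

/-- The concatenation of the first `n` homotopies of a sequence, parametrized by the real line. -/
noncomputable def concatHomotopies (H : ∀ n, (f n).HomotopyRel (f (n + 1)) (S n)) : ℕ → ℝ × X → Y
  | 0, p => f 0 p.2
  | n + 1, p => if p.1 ≤ n then concatHomotopies H n p
      else H n (Set.projIcc 0 1 zero_le_one (p.1 - n), p.2)

variable (H : ∀ n, (f n).HomotopyRel (f (n + 1)) (S n))

theorem concatHomotopies_of_le (n : ℕ) {p : ℝ × X} (h : n ≤ p.1) :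
    concatHomotopies H n p = f n p.2 := by
  cases n with
  | zero => rfl
  | succ n =>
    push_cast at h
    rw [concatHomotopies, if_neg (by linarith), Set.projIcc_of_right_le _ (by linarith)]
    exact (H n).apply_one _

theorem concatHomotopies_zero (n : ℕ) (x : X) : concatHomotopies H n (0, x) = f 0 x := by
  induction n with
  | zero => rfl
  | succ n ih => rw [concatHomotopies, if_pos (Nat.cast_nonneg n), ih]

theorem continuous_concatHomotopies (n : ℕ) : Continuous (concatHomotopies H n) := by
  induction n with
  | zero => exact (f 0).continuous.comp continuous_snd
  | succ n ih =>
    change Continuous fun p : ℝ × X => if p.1 ≤ n then concatHomotopies H n p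
      else H n (Set.projIcc 0 1 zero_le_one (p.1 - n), p.2)
    refine Continuous.if_le ih ((H n).continuous.comp ((continuous_projIcc.comp
      (continuous_fst.sub continuous_const)).prodMk continuous_snd)) continuous_fst
      continuous_const ?_
    intro p h
    rw [concatHomotopies_of_le H n h.ge, h, sub_self, Set.projIcc_of_le_left _ le_rfl]
    exact ((H n).apply_zero _).symm

theorem concatHomotopies_succ_of_mem (n : ℕ) {p : ℝ × X} (h : p.2 ∈ S n) :
    concatHomotopies H (n + 1) p = concatHomotopies H n p := by
  rw [concatHomotopies]
  split_ifs with h1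
  · rfl
  · rw [concatHomotopies_of_le H n (not_le.1 h1).le]
    exact (H n).eq_fst _ h

/-- An auxiliary reparametrization. -/
noncomputable def concatTime (n : ℕ) (t : ℝ) : ℝ := t / max (1 - t) (1 / (n + 1))

theorem continuous_concatTime (n : ℕ) : Continuous (concatTime n) := by
  refine Continuous.div continuous_id (by fun_prop) fun t => ?_
  have : (0 : ℝ) < 1 / (n + 1) := by positivity
  exact (this.trans_le (le_max_right _ _)).ne'

/-- As long as `1 - t ≥ 1/(n+1)`, both reparametrized times equal `t/(1-t)`. Afterwards both are at
least `n`, where the concatenation has already stopped at `f n x`. The lower bound in the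
denominator keeps the time finite at `t = 1`. -/
theorem concatHomotopies_concatTime_succ (n : ℕ) {t : ℝ} (ht : 0 ≤ t) {x : X} (h : x ∈ S n) :
    concatHomotopies H (n + 1) (concatTime (n + 1) t, x) =
      concatHomotopies H n (concatTime n t, x) := by
  rw [concatHomotopies_succ_of_mem H n h]
  have hn : (0 : ℝ) < n + 1 := by positivity
  have hlt : (1 : ℝ) / ((n + 1 : ℕ) + 1) < 1 / (n + 1) := by
    push_cast
    exact one_div_lt_one_div_of_lt hn (by linarith)
  rcases le_total (1 / ((n : ℝ) + 1)) (1 - t) with h1 | h1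
  · rw [concatTime, concatTime, max_eq_left h1, max_eq_left (hlt.le.trans h1)]
  · have hpos : (0 : ℝ) < 1 / ((n + 1 : ℕ) + 1) := by positivity
    have e1 : (n : ℝ) ≤ concatTime n t := by
      rw [concatTime, max_eq_right h1, le_div_iff₀ (by positivity), mul_one_div, div_le_iff₀ hn]
      have h2 : (1 - t) * (n + 1) ≤ 1 := (le_div_iff₀ hn).1 h1
      linarith
    have e2 : concatTime n t ≤ concatTime (n + 1) t := by
      rw [concatTime, concatTime]
      exact div_le_div_of_nonneg_left ht (hpos.trans_le (le_max_right _ _))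
        (max_le_max le_rfl hlt.le)
    have h3 : (n : ℝ) ≤ (concatTime (n + 1) t, x).1 := e1.trans e2
    have h4 : (n : ℝ) ≤ (concatTime n t, x).1 := e1
    rw [concatHomotopies_of_le H n h3, concatHomotopies_of_le H n h4]

/-- A sequence of homotopies which is locally eventually constant can be concatenated. -/
theorem exists_homotopic_limit (hH : ∀ n, (f n).HomotopicRel (f (n + 1)) (S n))
    (hmono : ∀ n, S n ⊆ S (n + 1)) (hloc : ∀ x, ∃ n, S n ∈ 𝓝 x) :
    ∃ g : C(X, Y), (f 0).Homotopic g ∧ ∀ n, ∀ x ∈ S n, g x = f n x := by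
  let H n := Classical.choice (hH n)
  choose N hN using hloc
  -- The index `N x` is chosen without continuity. By `hK` every `n` with `x ∈ S n` gives the same
  -- value, so near each point a single index can be used.
  let K (p : I × X) : Y := concatHomotopies H (N p.2) (concatTime (N p.2) p.1, p.2)
  have key (n k : ℕ) (t : I) (x : X) (hx : x ∈ S n) :
      concatHomotopies H (n + k) (concatTime (n + k) t, x) =
        concatHomotopies H n (concatTime n t, x) := by
    have hm : ∀ k, x ∈ S (n + k) := fun k => by
      induction k with
      | zero => exact hx
      | succ k ih => exact hmono _ ih
    induction k with
    | zero => rfl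
    | succ k ih => rw [← ih]; exact concatHomotopies_concatTime_succ H (n + k) t.2.1 (hm k)
  have hK (n : ℕ) (t : I) (x : X) (hx : x ∈ S n) :
      K (t, x) = concatHomotopies H n (concatTime n t, x) := by
    have hxN : x ∈ S (N x) := mem_of_mem_nhds (hN x)
    have e1 := key n (N x) t x hx
    have e2 := key (N x) n t x hxN
    rw [add_comm] at e2
    exact e2.symm.trans e1
  have hKc : Continuous K := by
    rw [continuous_iff_continuousAt]
    rintro ⟨t, x⟩
    have hc : Continuous fun p : I × X =>
        concatHomotopies H (N x) (concatTime (N x) p.1, p.2) :=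
      (continuous_concatHomotopies H (N x)).comp (((continuous_concatTime _).comp
        (by fun_prop)).prodMk continuous_snd)
    refine hc.continuousAt.congr ?_
    filter_upwards [continuous_snd.continuousAt.preimage_mem_nhds (hN x)] with p hp
    exact (hK (N x) p.1 p.2 hp).symm
  have hend (n : ℕ) (x : X) (hx : x ∈ S n) : K (1, x) = f n x := by
    rw [hK n 1 x hx]
    refine concatHomotopies_of_le H n ?_
    simp only [concatTime, Set.Icc.coe_one, sub_self]
    -- At `t = 1` the reparametrized time is `n + 1`, beyond the last of the first `n` homotopies.
    rw [max_eq_right (by positivity), one_div_one_div]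
    linarith
  refine ⟨⟨fun x => K (1, x), hKc.comp (by fun_prop)⟩, ⟨⟨⟨K, hKc⟩, fun x => ?_, fun x => rfl⟩⟩,
    fun n x hx => hend n x hx⟩
  change concatHomotopies H _ (concatTime _ (0 : I), x) = _
  rw [concatTime, Set.Icc.coe_zero, zero_div, concatHomotopies_zero]

end Limit

/-! ### Local formulas for transport in the total space -/

theorem ContinuousOn.ite_le {X α : Type*} [TopologicalSpace X] [TopologicalSpace α] {s : Set X}
    {f g : X → α} {a c : X → ℝ} (ha : Continuous a) (hc : Continuous c)
    (hf : ContinuousOn f (s ∩ {x | a x ≤ c x})) (hg : ContinuousOn g (s ∩ {x | c x ≤ a x}))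
    (hfg : ∀ x ∈ s, a x = c x → f x = g x) :
    ContinuousOn (fun x => if a x ≤ c x then f x else g x) s := by
  refine ContinuousOn.if (fun x hx => hfg x hx.1 (frontier_le_subset_eq ha hc hx.2))
    (hf.mono ?_) (hg.mono ?_)
  · rw [(isClosed_le ha hc).closure_eq]
  · simp only [not_le]
    exact Set.inter_subset_inter_right _ (closure_lt_subset_le hc ha)

namespace Clutch

open TwoSphere

/-- Additional stretching, used only at intermediate radii. -/
noncomputable def bump (r : ℝ) : I := clampI (min ((r - 13 / 50) * 25) ((3 / 5 - r) * 10))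

/-- Cut-off function near the pole. -/
noncomputable def cutoff (r : ℝ) : I := clampI ((3 / 4 - r) * 4)

/-- The parameter of `RZ.interp` at a given radius. -/
noncomputable def band (r : ℝ) : ℝ := (r - 3 / 10) * 50

@[fun_prop] theorem continuous_cutoff : Continuous cutoff := by unfold cutoff; fun_prop

/-- In this range the total stretching is by `2 · 2`, and `4 · 3/10 ≥ 1`; from radius `1/2` on the
factor `2` suffices. So all points of radius at least `3/10` come to lie over the pole, where the
fibre coordinate can be deformed without moving in the sphere. -/
theorem bump_eq_one {r : ℝ} (h1 : 3 / 10 ≤ r) (h2 : r ≤ 1 / 2) : bump r = 1 :=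
  clampI_of_one_le (le_min (by linarith) (by linarith))

theorem cutoff_eq_one {r : ℝ} (h : r ≤ 1 / 2) : cutoff r = 1 := clampI_of_one_le (by linarith)

theorem cutoff_eq_zero {r : ℝ} (h : 3 / 4 ≤ r) : cutoff r = 0 := clampI_of_nonpos (by linarith)

/-- The slope `50` takes the radii from `3/10` to `19/50` to the parameter interval `[0, 4]` of
`RZ.interp`. -/
theorem band_left : band (3 / 10) = 0 := by norm_num [band]

theorem band_right : band (19 / 50) = 4 := by norm_num [band]

section Facts

variable {e : Clutch} {b : TwoSphere}

theorem rho_proj (h : TwoSphere.push 2 b = e.proj) : e.proj.rho = min 1 (2 * b.rho) := by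
  rw [← h, rho_push]; norm_num

theorem sec_proj (h : TwoSphere.push 2 b = e.proj) (hr : b.rho < 1 / 2) :
    e.proj.sec = b.sec.clamp 2 := by
  rw [← h, TwoSphere.push, sec_ofDisc]
  rw [Disc.norm_clamp, norm_sec]
  norm_num
  linarith

theorem eq_mk_inner (h : TwoSphere.push 2 b = e.proj) (hr : b.rho < 1 / 2) :
    e = mk (b.sec.clamp 2) e.inner := by
  rw [← sec_proj h hr]
  refine eq_mk ?_
  rw [rho_proj h]
  exact min_lt_of_right_lt (by linarith)

theorem push_eq_mk_inner (h : TwoSphere.push 2 b = e.proj) (hr : b.rho < 1 / 2) {a : ℝ}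
    (ha : 1 ≤ a) : push a e = mk (b.sec.clamp (2 * a)) e.inner := by
  conv_lhs => rw [eq_mk_inner h hr]
  rw [push_mk, Disc.clamp_clamp a 2 (by norm_num) ha, mul_comm]

theorem outer_eq_mul_inner (h : TwoSphere.push 2 b = e.proj) (h0 : 0 < b.rho)
    (hr : b.rho < 1 / 2) : e.outer = RZ.mul b.dir e.inner := by
  have hd : e.proj.dir = b.dir := by
    rw [TwoSphere.dir, sec_proj h hr, Disc.dir_clamp, TwoSphere.dir]
  rw [← hd]
  refine outer_eq ?_ ?_
  · rw [rho_proj h]; exact lt_min one_pos (by linarith)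
  · rw [rho_proj h]; exact min_lt_of_right_lt (by linarith)

theorem eq_base_outer (h : TwoSphere.push 2 b = e.proj) (hr : 1 / 2 ≤ b.rho) :
    e = base e.outer := by
  refine eq_base ?_
  rw [rho_proj h, min_eq_left (by linarith)]

theorem push_bump_eq_base (h : TwoSphere.push 2 b = e.proj) (hr : 3 / 10 ≤ b.rho) :
    push (1 + bump b.rho) e = base e.outer := by
  rcases le_total b.rho (1 / 2) with h2 | h2
  · refine push_eq_base ?_
    have h3 : (1 : ℝ) / 2 ≤ min 1 (2 * b.rho) := le_min (by norm_num) (by linarith)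
    rw [rho_proj h, bump_eq_one hr h2, Set.Icc.coe_one, max_eq_left (by norm_num)]
    linarith
  · conv_lhs => rw [eq_base_outer h h2]
    exact push_base _ _

theorem push_two_bump_eq_pole (hr : 3 / 10 ≤ b.rho) :
    TwoSphere.push (2 * (1 + bump b.rho)) b = pole := by
  refine push_eq_pole ?_
  rcases le_total b.rho (1 / 2) with h2 | h2
  · rw [bump_eq_one hr h2]
    norm_num
    linarith
  · have := (bump b.rho).2.1
    rw [max_eq_left (by linarith)]
    nlinarith

end Facts

section Continuity

variable {X : Type*} [TopologicalSpace X] {e : X → Clutch} {b : X → TwoSphere}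

theorem continuousOn_inner_comp (he : Continuous e)
    (h : ∀ x, TwoSphere.push 2 (b x) = (e x).proj) :
    ContinuousOn (fun x => (e x).inner) {x | (b x).rho < 1 / 2} :=
  continuousOn_inner.comp he.continuousOn fun x hx => by
    change (e x).proj.rho < 1
    rw [rho_proj (h x)]
    exact min_lt_of_right_lt (by linarith [show (b x).rho < 1 / 2 from hx])

theorem continuousOn_outer_comp (he : Continuous e)
    (h : ∀ x, TwoSphere.push 2 (b x) = (e x).proj) :
    ContinuousOn (fun x => (e x).outer) {x | 0 < (b x).rho} :=
  continuousOn_outer.comp he.continuousOn fun x hx => by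
    change 0 < (e x).proj.rho
    rw [rho_proj (h x)]
    exact lt_min one_pos (by linarith [show 0 < (b x).rho from hx])

theorem continuousOn_dir_comp (hb : Continuous b) :
    ContinuousOn (fun x => (b x).dir) {x | 0 < (b x).rho ∧ (b x).rho < 1} :=
  continuousOn_dir.comp hb.continuousOn fun _ hx => hx

theorem continuousOn_sec_comp (hb : Continuous b) :
    ContinuousOn (fun x => (b x).sec) {x | (b x).rho < 1} :=
  continuousOn_sec.comp hb.continuousOn fun _ hx => hx

end Continuity

/-- The vertical part of the change of trivialization. -/
noncomputable def vertical (e : Clutch) (b : TwoSphere) (s : I) : Clutch :=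
  if b.rho ≤ 3 / 10 then push (1 + bump b.rho) e
  else if b.rho ≤ 19 / 50 then base (RZ.interp b.dir e.inner (band b.rho) (3 * s))
  else if b.rho ≤ 3 / 4 then base (RZ.cancel b.dir (clampI (3 * s - 2) * cutoff b.rho) e.outer)
  else base e.outer

/-- A point of the total space over `push 2 b`, depending on a point of the fibre over the pole. -/
noncomputable def spread (b : TwoSphere) (z : RZ) : Clutch :=
  if b.rho ≤ 1 / 2 then mk (b.sec.clamp 2) (RZ.mul b.dir⁻¹ z)
  else if b.rho ≤ 3 / 4 then base (RZ.cancel b.dir (cutoff b.rho) z)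
  else base z

/-- Undoing the stretching after the change of trivialization. -/
noncomputable def shrink (e : Clutch) (b : TwoSphere) (s : I) : Clutch :=
  if b.rho ≤ 3 / 10 then push (1 + (σ s : I) * bump b.rho) e
  else if b.rho ≤ 19 / 50 then mk (b.sec.clamp (2 * (1 + (σ s : I) * bump b.rho)))
    (RZ.interpEnd b.dir e.inner (band b.rho))
  else if b.rho ≤ 1 / 2 then mk (b.sec.clamp (2 * (1 + (σ s : I) * bump b.rho)))
    (RZ.mul b.dir⁻¹ e.outer)
  else if b.rho ≤ 3 / 4 then base (RZ.cancel b.dir (cutoff b.rho) e.outer)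
  else base e.outer

/-- Transport of the point `e` over `push 2 b` to a point over `push 2 b''`. -/
noncomputable def transport (e : Clutch) (b b' b'' : TwoSphere) : Clutch :=
  if b.rho ≤ 3 / 10 then mk (b''.sec.clamp 2) e.inner
  else if b.rho ≤ 19 / 50 then mk (b''.sec.clamp 2) (RZ.interpEnd b.dir e.inner (band b.rho))
  else if b.rho ≤ 21 / 50 then mk (b''.sec.clamp 2) (RZ.mul b'.dir⁻¹ e.outer)
  else spread b'' e.outer

/-! ### End points and projections of the deformations. -/

section Endpoints

variable {e : Clutch} {b : TwoSphere}

theorem vertical_zero (h : TwoSphere.push 2 b = e.proj) :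
    vertical e b 0 = push (1 + bump b.rho) e := by
  rw [vertical]
  split_ifs with h1 h2 h3
  · rfl
  · rw [push_bump_eq_base h (by linarith), Set.Icc.coe_zero, mul_zero, RZ.interp_start,
      outer_eq_mul_inner h (by linarith) (by linarith)]
  · rw [push_bump_eq_base h (by linarith), Set.Icc.coe_zero, clampI_of_nonpos (by norm_num),
      zero_mul, RZ.cancel_zero]
  · rw [push_bump_eq_base h (by linarith)]

theorem clamp_bump {r : ℝ} (hr : b.rho = r) (h1 : 3 / 10 ≤ r) (h2 : r ≤ 1 / 2) :
    b.sec.clamp (2 * (1 + bump b.rho)) = Disc.bdry b.dir := by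
  rw [Disc.clamp_of_one_le, TwoSphere.dir]
  rw [norm_sec, hr, bump_eq_one h1 h2]
  norm_num
  linarith

/-- At full stretching the disc coordinate is the boundary point `x = b.dir`, and `(x, z')` is glued
to `x z'` over the pole. To let the disc coordinate return to the interior, the vertical deformation
must end at multiples of `x` with a specified cofactor: `interpEnd` below `19/50`, and `x⁻¹` times
the outer coordinate from there up to `1/2`. -/
theorem shrink_zero : shrink e b 0 = vertical e b 1 := by
  rw [shrink, vertical]
  simp only [unitInterval.symm_zero, Set.Icc.coe_one, one_mul, mul_one]
  rw [show clampI (3 - 2) = 1 from clampI_of_one_le (by norm_num), one_mul]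
  split_ifs with h1 h2 h3 h4 h4
  · rfl
  · rw [clamp_bump rfl (by linarith) (by linarith), mk_bdry, RZ.interp_end]
  · rw [clamp_bump rfl (by linarith) h3, mk_bdry, cutoff_eq_one h3, RZ.cancel_one]
  · linarith
  · rfl
  · rfl

/-- With the additional stretching undone, the change of coordinates is the transport along a path
of length zero, from which `PushFamily.move` starts. -/
theorem shrink_one (h : TwoSphere.push 2 b = e.proj) : shrink e b 1 = transport e b b b := by
  rw [shrink, transport, spread]
  simp only [unitInterval.symm_one, Set.Icc.coe_zero, zero_mul, add_zero, mul_one]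
  split_ifs with h1 h2 h3 h4 h5 h6 h7
  · rw [push_eq_mk_inner h (by linarith) le_rfl, mul_one]
  all_goals first | rfl | linarith

theorem proj_vertical (h : TwoSphere.push 2 b = e.proj) (s : I) :
    TwoSphere.push (2 * (1 + bump b.rho)) b = (vertical e b s).proj := by
  rw [vertical]
  split_ifs with h1 h2 h3
  · rw [proj_push, ← h, push_push _ (by norm_num), mul_comm]
    linarith [(bump b.rho).2.1]
  all_goals exact push_two_bump_eq_pole (by linarith)

theorem push_eq_pole_of_half_le {m : ℝ} (hm : 2 ≤ m) (hr : 1 / 2 ≤ b.rho) :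
    TwoSphere.push m b = pole := by
  refine push_eq_pole ?_
  rw [max_eq_left (by linarith)]
  nlinarith

theorem proj_shrink (h : TwoSphere.push 2 b = e.proj) (s : I) :
    TwoSphere.push (2 * (1 + (σ s : I) * bump b.rho)) b = (shrink e b s).proj := by
  have h0 : (0 : ℝ) ≤ (σ s : I) * bump b.rho := mul_nonneg (σ s).2.1 (bump b.rho).2.1
  rw [shrink]
  split_ifs with h1 h2 h3 h4
  · rw [proj_push, ← h, push_push (by linarith) (by norm_num), mul_comm]
  · rfl
  · rfl
  · exact push_eq_pole_of_half_le (by linarith) (by linarith)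
  · exact push_eq_pole_of_half_le (by linarith) (by linarith)

theorem proj_spread (z : RZ) : TwoSphere.push 2 b = (spread b z).proj := by
  rw [spread]
  split_ifs with h1 h2
  · rfl
  · exact push_eq_pole_of_half_le le_rfl (by linarith)
  · exact push_eq_pole_of_half_le le_rfl (by linarith)

theorem proj_transport (b' b'' : TwoSphere) :
    TwoSphere.push 2 b'' = (transport e b b' b'').proj := by
  rw [transport]
  split_ifs with h1 h2 h3
  · rfl
  · rfl
  · rfl
  · exact proj_spread _

theorem spread_pole (z : RZ) : spread pole z = base z := by
  rw [spread, rho_pole, if_neg (by norm_num), if_neg (by norm_num)]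

theorem vertical_pole (s : I) : vertical e pole s = base e.outer := by
  rw [vertical, rho_pole, if_neg (by norm_num), if_neg (by norm_num), if_neg (by norm_num)]

theorem shrink_pole (s : I) : shrink e pole s = base e.outer := by
  rw [shrink, rho_pole, if_neg (by norm_num), if_neg (by norm_num), if_neg (by norm_num),
    if_neg (by norm_num)]

theorem transport_pole (b' : TwoSphere) : transport e pole b' pole = base e.outer := by
  rw [transport, rho_pole, if_neg (by norm_num), if_neg (by norm_num), if_neg (by norm_num),
    spread_pole]

end Endpoints

section Continuity

variable {X : Type*} [TopologicalSpace X] {e : X → Clutch} {b : X → TwoSphere}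

theorem _root_.ContinuousOn.clutchBase {z : X → RZ} {S : Set X} (hz : ContinuousOn z S) :
    ContinuousOn (fun x => Clutch.base (z x)) S :=
  continuous_base.comp_continuousOn hz

/-- At radius `3/10` the path `interp` is constant. At `19/50` it rests for two thirds of the time
and then runs through `cancel`, which explains the factor `clampI (3 * s - 2)` in the next region.
The cut-off makes this homotopy die out at `3/4`. -/
theorem continuous_vertical (he : Continuous e) (hb : Continuous b)
    (h : ∀ x, TwoSphere.push 2 (b x) = (e x).proj) {s : X → I} (hs : Continuous s) :
    Continuous fun x => vertical (e x) (b x) (s x) := by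
  have hr : Continuous fun x => (b x).rho := continuous_rho.comp hb
  have hin := continuousOn_inner_comp he h
  have hout := continuousOn_outer_comp he h
  have hdir := continuousOn_dir_comp hb
  rw [← continuousOn_univ]
  unfold vertical
  refine ContinuousOn.ite_le hr continuous_const (Continuous.continuousOn (by fun_prop))
    (ContinuousOn.ite_le hr continuous_const ?_ (ContinuousOn.ite_le hr continuous_const
      ?_ ?_ ?_) ?_) ?_
  · refine ContinuousOn.clutchBase (RZ.continuous_interp.comp_continuousOn
      (ContinuousOn.prodMk (hdir.mono ?_) (ContinuousOn.prodMk (hin.mono ?_)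
        (ContinuousOn.prodMk (Continuous.continuousOn (by fun_prop))
          (Continuous.continuousOn (by fun_prop))))))
    · rintro x ⟨⟨-, h1⟩, h2⟩
      simp only [Set.mem_ofPred_eq] at *
      constructor <;> linarith
    · rintro x ⟨⟨-, h1⟩, h2⟩
      simp only [Set.mem_ofPred_eq] at *
      linarith
  · refine ContinuousOn.clutchBase (ContinuousOn.rzCancel (hdir.mono ?_)
      (Continuous.continuousOn (by fun_prop)) (hout.mono ?_))
    · rintro x ⟨⟨⟨-, h1⟩, h2⟩, h3⟩
      simp only [Set.mem_ofPred_eq] at *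
      constructor <;> linarith
    · rintro x ⟨⟨⟨-, h1⟩, h2⟩, h3⟩
      simp only [Set.mem_ofPred_eq] at *
      linarith
  · refine ContinuousOn.clutchBase (hout.mono ?_)
    rintro x ⟨⟨⟨-, h1⟩, h2⟩, h3⟩
    simp only [Set.mem_ofPred_eq] at *
    linarith
  · rintro x - hx
    rw [hx, cutoff_eq_zero le_rfl, mul_zero, RZ.cancel_zero]
  · rintro x - hx
    rw [if_pos (by rw [hx]; norm_num), hx, band_right, RZ.interp_right,
      cutoff_eq_one (by norm_num), mul_one,
      outer_eq_mul_inner (h x) (by rw [hx]; norm_num) (by rw [hx]; norm_num)]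
  · rintro x - hx
    rw [if_pos (by rw [hx]; norm_num), push_bump_eq_base (h x) (by rw [hx]), hx, band_left,
      RZ.interp_left, outer_eq_mul_inner (h x) (by rw [hx]; norm_num) (by rw [hx]; norm_num)]

/-- At radius `1/2` the stretched disc coordinate reaches the boundary, and gluing turns `x⁻¹ z`
into `x x⁻¹ z`, the end of `cancel x`. Beyond this radius the cut-off leads back along `cancel x` to
`z`. -/
theorem spread_eq_aux {b : TwoSphere} (hb : b.rho = 1 / 2) {m : ℝ} (hm : 2 ≤ m) (z : RZ) :
    mk (b.sec.clamp m) (RZ.mul b.dir⁻¹ z) = base (RZ.cancel b.dir (cutoff b.rho) z) := by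
  rw [Disc.clamp_of_one_le, mk_bdry, cutoff_eq_one hb.le, RZ.cancel_one, TwoSphere.dir]
  rw [norm_sec, hb, max_eq_left (by linarith)]
  linarith

theorem continuousOn_spread {S : Set X} {z : X → RZ} (hb : Continuous b) (hz : ContinuousOn z S)
    (h0 : ∀ x ∈ S, 0 < (b x).rho) : ContinuousOn (fun x => spread (b x) (z x)) S := by
  have hr : Continuous fun x => (b x).rho := continuous_rho.comp hb
  have hdir := continuousOn_dir_comp hb
  have hsec := continuousOn_sec_comp hb
  unfold spread
  refine ContinuousOn.ite_le hr continuous_const ?_ (ContinuousOn.ite_le hr continuous_const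
    ?_ ?_ ?_) ?_
  · refine ContinuousOn.clutchMk (ContinuousOn.discClamp continuousOn_const (hsec.mono ?_))
      (ContinuousOn.rzMul (ContinuousOn.inv (hdir.mono ?_)) (hz.mono ?_))
    · rintro x ⟨h1, h2⟩
      simp only [Set.mem_ofPred_eq] at *
      linarith
    · rintro x ⟨h1, h2⟩
      have := h0 x h1
      simp only [Set.mem_ofPred_eq] at *
      constructor <;> linarith
    · exact fun x hx => hx.1
  · refine ContinuousOn.clutchBase (ContinuousOn.rzCancel (hdir.mono ?_)
      (Continuous.continuousOn (by fun_prop)) (hz.mono ?_))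
    · rintro x ⟨⟨h1, h2⟩, h3⟩
      simp only [Set.mem_ofPred_eq] at *
      constructor <;> linarith
    · exact fun x hx => hx.1.1
  · exact ContinuousOn.clutchBase (hz.mono fun x hx => hx.1.1)
  · rintro x - hx
    rw [hx, cutoff_eq_zero le_rfl, RZ.cancel_zero]
  · rintro x - hx
    rw [if_pos (by rw [hx]; norm_num), spread_eq_aux hx le_rfl]

theorem continuous_shrink (he : Continuous e) (hb : Continuous b)
    (h : ∀ x, TwoSphere.push 2 (b x) = (e x).proj) {s : X → I} (hs : Continuous s) :
    Continuous fun x => shrink (e x) (b x) (s x) := by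
  have hr : Continuous fun x => (b x).rho := continuous_rho.comp hb
  have hin := continuousOn_inner_comp he h
  have hout := continuousOn_outer_comp he h
  have hdir := continuousOn_dir_comp hb
  have hsec := continuousOn_sec_comp hb
  have h0 (x : X) : (0 : ℝ) ≤ (σ (s x) : I) * bump (b x).rho :=
    mul_nonneg (σ (s x)).2.1 (bump (b x).rho).2.1
  rw [← continuousOn_univ]
  unfold shrink
  refine ContinuousOn.ite_le hr continuous_const (Continuous.continuousOn (by fun_prop))
    (ContinuousOn.ite_le hr continuous_const ?_ (ContinuousOn.ite_le hr continuous_const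
      ?_ (ContinuousOn.ite_le hr continuous_const ?_ ?_ ?_) ?_) ?_) ?_
  · refine ContinuousOn.clutchMk (ContinuousOn.discClamp (Continuous.continuousOn (by fun_prop))
      (hsec.mono ?_)) (RZ.continuous_interpEnd.comp_continuousOn
      (ContinuousOn.prodMk (hdir.mono ?_) (ContinuousOn.prodMk (hin.mono ?_)
        (Continuous.continuousOn (by fun_prop)))))
    all_goals
      rintro x ⟨⟨-, h1⟩, h2⟩
      simp only [Set.mem_ofPred_eq] at *
      first | linarith | constructor <;> linarith
  · refine ContinuousOn.clutchMk (ContinuousOn.discClamp (Continuous.continuousOn (by fun_prop))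
      (hsec.mono ?_)) (ContinuousOn.rzMul (ContinuousOn.inv (hdir.mono ?_)) (hout.mono ?_))
    all_goals
      rintro x ⟨⟨⟨-, h1⟩, h2⟩, h3⟩
      simp only [Set.mem_ofPred_eq] at *
      first | linarith | constructor <;> linarith
  · refine ContinuousOn.clutchBase (ContinuousOn.rzCancel (hdir.mono ?_)
      (Continuous.continuousOn (by fun_prop)) (hout.mono ?_))
    all_goals
      rintro x ⟨⟨⟨⟨-, h1⟩, h2⟩, h3⟩, h4⟩
      simp only [Set.mem_ofPred_eq] at *
      first | linarith | constructor <;> linarith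
  · refine ContinuousOn.clutchBase (hout.mono ?_)
    rintro x ⟨⟨⟨⟨-, h1⟩, h2⟩, h3⟩, h4⟩
    simp only [Set.mem_ofPred_eq] at *
    linarith
  · rintro x - hx
    rw [hx, cutoff_eq_zero le_rfl, RZ.cancel_zero]
  · rintro x - hx
    rw [if_pos (by rw [hx]; norm_num), spread_eq_aux hx (by linarith [h0 x])]
  · rintro x - hx
    rw [if_pos (by rw [hx]; norm_num),
      outer_eq_mul_inner (h x) (by rw [hx]; norm_num) (by rw [hx]; norm_num)]
    conv_lhs => rw [show band (b x).rho = 4 by rw [hx, band_right], RZ.interpEnd_right]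
  · rintro x - hx
    rw [if_pos (by rw [hx]; norm_num), push_eq_mk_inner (h x) (by rw [hx]; norm_num)
      (by linarith [h0 x])]
    conv_rhs => rw [show band (b x).rho = 0 by rw [hx, band_left], RZ.interpEnd_left]

/-- At radius `19/50` the fibre coordinate is `x⁻¹ (x z)` with `x` the direction of the old point
`b`, while `spread` divides by the direction of the new point `b''`. The auxiliary point `b'` passes
from one to the other up to radius `21/50`. The bound `1/20` keeps `b'` and `b''` away from the
center when `b` has radius at least `19/50`, so that directions are continuous, and keeps `b''`
below radius `1/2` when `b` has radius at most `21/50`. -/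
theorem continuous_transport {b' b'' : X → TwoSphere} (he : Continuous e) (hb : Continuous b)
    (hb' : Continuous b') (hb'' : Continuous b'')
    (h : ∀ x, TwoSphere.push 2 (b x) = (e x).proj)
    (h' : ∀ x, |(b' x).rho - (b x).rho| < 1 / 20)
    (h'' : ∀ x, |(b'' x).rho - (b x).rho| < 1 / 20)
    (h1 : ∀ x, (b x).rho = 19 / 50 → b' x = b x)
    (h2 : ∀ x, (b x).rho = 21 / 50 → b' x = b'' x) :
    Continuous fun x => transport (e x) (b x) (b' x) (b'' x) := by
  have hr : Continuous fun x => (b x).rho := continuous_rho.comp hb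
  have hin := continuousOn_inner_comp he h
  have hout := continuousOn_outer_comp he h
  have hdir := continuousOn_dir_comp hb
  have hdir' := continuousOn_dir_comp hb'
  have hsec := continuousOn_sec_comp hb''
  simp only [abs_lt] at h' h''
  rw [← continuousOn_univ]
  unfold transport
  refine ContinuousOn.ite_le hr continuous_const ?_
    (ContinuousOn.ite_le hr continuous_const ?_ (ContinuousOn.ite_le hr continuous_const
      ?_ ?_ ?_) ?_) ?_
  · refine ContinuousOn.clutchMk (ContinuousOn.discClamp continuousOn_const
      (hsec.mono ?_)) (hin.mono ?_)
    all_goals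
      rintro x ⟨-, k1⟩
      have := h'' x
      simp only [Set.mem_ofPred_eq] at *
      linarith
  · refine ContinuousOn.clutchMk (ContinuousOn.discClamp continuousOn_const
      (hsec.mono ?_)) (RZ.continuous_interpEnd.comp_continuousOn
      (ContinuousOn.prodMk (hdir.mono ?_) (ContinuousOn.prodMk (hin.mono ?_)
        (Continuous.continuousOn (by fun_prop)))))
    all_goals
      rintro x ⟨⟨-, k1⟩, k2⟩
      have := h'' x
      simp only [Set.mem_ofPred_eq] at *
      first | linarith | constructor <;> linarith
  · refine ContinuousOn.clutchMk (ContinuousOn.discClamp continuousOn_const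
      (hsec.mono ?_)) (ContinuousOn.rzMul (ContinuousOn.inv (hdir'.mono ?_)) (hout.mono ?_))
    all_goals
      rintro x ⟨⟨⟨-, k1⟩, k2⟩, k3⟩
      have := h'' x
      have := h' x
      simp only [Set.mem_ofPred_eq] at *
      first | linarith | constructor <;> linarith
  · refine continuousOn_spread hb'' (hout.mono ?_) ?_
    all_goals
      rintro x ⟨⟨⟨-, k1⟩, k2⟩, k3⟩
      have := h'' x
      simp only [Set.mem_ofPred_eq] at *
      linarith
  · rintro x - hx
    have := h'' x
    rw [hx] at this
    rw [spread, if_pos (by linarith), h2 x hx]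
  · rintro x - hx
    rw [if_pos (by rw [hx]; norm_num), h1 x hx,
      outer_eq_mul_inner (h x) (by rw [hx]; norm_num) (by rw [hx]; norm_num), hx, band_right,
      RZ.interpEnd_right]
  · rintro x - hx
    rw [if_pos (by rw [hx]; norm_num), hx, band_left, RZ.interpEnd_left]

end Continuity

end Clutch

/-! ### The homotopy fibre deforms to the fibre -/

theorem abs_coe_clampI_sub_le (a b : ℝ) : |(clampI a : ℝ) - clampI b| ≤ |a - b| :=
  Set.abs_projIcc_sub_projIcc zero_le_one

/-- A family of points of the total space over the points `push m (γ t)`. -/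
structure PushFamily {X : Type*} [TopologicalSpace X] (γ : C(X, C(I, TwoSphere)))
    (m : X → ℝ) where
  /-- The point of the total space. -/
  e : X → Clutch
  /-- The time. -/
  t : X → ℝ
  continuous_e : Continuous e
  continuous_t : Continuous t
  proj : ∀ x, TwoSphere.push (m x) (γ x (clampI (t x))) = (e x).proj
  nonneg : ∀ x, 0 ≤ t x

namespace PushFamily

open TwoSphere

section

variable {X : Type*} [TopologicalSpace X] {γ : C(X, C(I, TwoSphere))} {m : X → ℝ}

/-- The family of paths over `I × X` which does not depend on the first coordinate. -/
def cylinder (γ : C(X, C(I, TwoSphere))) : C(I × X, C(I, TwoSphere)) := γ.comp ContinuousMap.snd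

theorem cylinder_one (hγ : ∀ x, γ x 1 = pole) (p : I × X) : cylinder γ p 1 = pole := hγ p.2

/-- The map to the homotopy fibre given by a family. -/
noncomputable def toMap (P : PushFamily γ m) (hγ : ∀ x, γ x 1 = pole) (hm : Continuous m) :
    C(X, HoFiber) where
  toFun x := HoFiber.ofPush (P.e x) (γ x) (P.t x) (m x) (P.proj x) (P.nonneg x) (hγ x)
  continuous_toFun := HoFiber.continuous_ofPush P.continuous_e γ.continuous P.continuous_t hm _ _ _

theorem toMap_congr {Y : Type*} [TopologicalSpace Y] {γ' : C(Y, C(I, TwoSphere))} {n : Y → ℝ}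
    {P : PushFamily γ m} {Q : PushFamily γ' n} {hγ : ∀ x, γ x 1 = pole} {hγ' : ∀ y, γ' y 1 = pole}
    {hm : Continuous m} {hn : Continuous n} {x : X} {y : Y} (h : γ x = γ' y) (he : P.e x = Q.e y)
    (ht : P.t x = Q.t y) (h' : m x = n y) : P.toMap hγ hm x = Q.toMap hγ' hn y := by
  refine Subtype.ext (Prod.ext he (ContinuousMap.ext fun u => ?_))
  change TwoSphere.push (m x) (γ x (clampI (P.t x + u))) =
    TwoSphere.push (n y) (γ' y (clampI (Q.t y + u)))
  rw [h, ht, h']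

theorem toMap_eq_ofBase (P : PushFamily γ m) (hγ : ∀ x, γ x 1 = pole) (hm : Continuous m) {x : X}
    (h : 1 ≤ P.t x) : P.toMap hγ hm x = HoFiber.ofBase (P.e x).outer :=
  HoFiber.ofPush_eq_ofBase (h := P.proj x) (ht := P.nonneg x) (hγ := hγ x) h

/-- A family over `I × X` is a homotopy of maps to the homotopy fibre. -/
theorem homotopicRel {m : I × X → ℝ} (P : PushFamily (cylinder γ) m)
    (hγ : ∀ x, γ x 1 = pole) (hm : Continuous m) {S : Set X} {f g : C(X, HoFiber)}
    (hS : ∀ x ∈ S, ∀ τ, 1 ≤ P.t (τ, x) ∧ (P.e (τ, x)).outer = (P.e (0, x)).outer)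
    (hf : ∀ x, P.toMap (cylinder_one hγ) hm (0, x) = f x)
    (hg : ∀ x, P.toMap (cylinder_one hγ) hm (1, x) = g x) : f.HomotopicRel g S :=
  ⟨⟨⟨P.toMap (cylinder_one hγ) hm, hf, hg⟩, fun τ x hx => by
    change P.toMap (cylinder_one hγ) hm (τ, x) = f x
    rw [← hf, toMap_eq_ofBase _ _ _ (hS x hx τ).1, toMap_eq_ofBase _ _ _ (hS x hx 0).1,
      (hS x hx τ).2]⟩⟩

/-- The base point of a family. -/
noncomputable def pt (P : PushFamily γ m) (x : X) : TwoSphere := γ x (clampI (P.t x))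

/-- The base point after time `r`. -/
noncomputable def later (P : PushFamily γ m) (x : X) (r : ℝ) : TwoSphere :=
  γ x (clampI (P.t x + r))

theorem later_zero (P : PushFamily γ m) (x : X) : P.later x 0 = P.pt x := by
  rw [later, add_zero, pt]

theorem continuous_pt (P : PushFamily γ m) : Continuous P.pt := by
  have := P.continuous_t
  unfold pt
  fun_prop

theorem continuous_later (P : PushFamily γ m) :
    Continuous fun p : X × ℝ => P.later p.1 p.2 := by
  have := P.continuous_t
  unfold later
  fun_prop

theorem later_eq_pole (P : PushFamily γ m) (hγ : ∀ x, γ x 1 = pole) {x : X} (h : 1 ≤ P.t x)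
    {r : ℝ} (hr : 0 ≤ r) : P.later x r = pole := by
  rw [later, clampI_of_one_le (by linarith), hγ]

theorem pt_eq_pole (P : PushFamily γ m) (hγ : ∀ x, γ x 1 = pole) {x : X} (h : 1 ≤ P.t x) :
    P.pt x = pole := by
  rw [← later_zero, P.later_eq_pole hγ h le_rfl]

theorem outer_push_of_proj_eq_pole {e : Clutch} (h : e.proj = pole) (a : ℝ) :
    (Clutch.push a e).outer = e.outer := by
  rw [Clutch.eq_base (e := e) (by rw [h, rho_pole]), Clutch.push_base]

/-- A bound for the times during which the distance to the center changes little. -/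
def IsModulus (γ : C(I, TwoSphere)) (d : ℝ) : Prop :=
  0 < d ∧ ∀ s t : I, |(s : ℝ) - t| ≤ d → |(γ s).rho - (γ t).rho| < 1 / 20

variable {δ : C(X, ℝ)} (hδ : ∀ x, IsModulus (γ x) (δ x))

theorem abs_rho_later_sub (hδ : ∀ x, IsModulus (γ x) (δ x)) (P : PushFamily γ m) (x : X) {r : ℝ}
    (h0 : 0 ≤ r) (h1 : r ≤ δ x) :
    |(P.later x r).rho - (P.pt x).rho| < 1 / 20 := by
  refine (hδ x).2 _ _ ((abs_coe_clampI_sub_le _ _).trans ?_)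
  rwa [add_sub_cancel_left, abs_of_nonneg h0]

/-- An auxiliary delay, depending on the distance to the center. -/
noncomputable def delay (r : ℝ) : I := clampI ((r - 19 / 50) * 25)

/-- The homotopy transporting the family along the paths. -/
noncomputable def move (P : PushFamily γ fun _ => 2) (p : I × X) : Clutch :=
  Clutch.transport (P.e p.2) (P.pt p.2)
    (P.later p.2 (min (p.1 : ℝ) (delay (P.pt p.2).rho) * δ p.2))
    (P.later p.2 (p.1 * δ p.2))

theorem continuous_move (hδ : ∀ x, IsModulus (γ x) (δ x)) (P : PushFamily γ fun _ => 2) : Continuous (P.move (δ := δ)) := by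
  have hp := P.continuous_pt
  have hd := fun x => (hδ x).1.le
  have hmin (p : I × X) : 0 ≤ min (p.1 : ℝ) (delay (P.pt p.2).rho) :=
    le_min p.1.2.1 (delay _).2.1
  unfold move
  refine Clutch.continuous_transport (P.continuous_e.comp continuous_snd)
    (hp.comp continuous_snd) ?_ ?_ (fun p => P.proj p.2) (fun p => ?_) (fun p => ?_)
    (fun p h => ?_) fun p h => ?_
  · exact P.continuous_later.comp (by fun_prop : Continuous fun p : I × X =>
      (p.2, min (p.1 : ℝ) (delay (P.pt p.2).rho) * δ p.2))
  · exact P.continuous_later.comp (by fun_prop : Continuous fun p : I × X =>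
      (p.2, (p.1 : ℝ) * δ p.2))
  · exact P.abs_rho_later_sub hδ _ (mul_nonneg (hmin p) (hd _))
      (mul_le_of_le_one_left (hd _) ((min_le_left _ _).trans p.1.2.2))
  · exact P.abs_rho_later_sub hδ _ (mul_nonneg p.1.2.1 (hd _))
      (mul_le_of_le_one_left (hd _) p.1.2.2)
  -- The delay is `0` at radius `19/50` and `1` at `21/50`, so the auxiliary point rests at the
  -- first seam and moves with the path at the second.
  · rw [h, delay, clampI_of_nonpos (by norm_num), Set.Icc.coe_zero, min_eq_right p.1.2.1,
      zero_mul, later_zero]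
  · rw [h, delay, clampI_of_one_le (by norm_num), Set.Icc.coe_one, min_eq_left p.1.2.2]

/-- The family over `I × X` given by `move`. -/
noncomputable def moveFamily (P : PushFamily γ fun _ => 2) :
    PushFamily (cylinder γ) fun _ => 2 where
  e := P.move (δ := δ)
  t p := P.t p.2 + p.1 * δ p.2
  continuous_e := P.continuous_move hδ
  continuous_t := by
    have := P.continuous_t
    fun_prop
  proj _ := Clutch.proj_transport _ _
  nonneg p := add_nonneg (P.nonneg p.2) (mul_nonneg p.1.2.1 (hδ p.2).1.le)

/-- The transported family. -/
noncomputable def next (P : PushFamily γ fun _ => 2) : PushFamily γ fun _ => 2 where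
  e x := (P.moveFamily hδ).e (1, x)
  t x := (P.moveFamily hδ).t (1, x)
  continuous_e := (P.moveFamily hδ).continuous_e.comp (Continuous.prodMk_right 1)
  continuous_t := (P.moveFamily hδ).continuous_t.comp (Continuous.prodMk_right 1)
  proj x := (P.moveFamily hδ).proj (1, x)
  nonneg x := (P.moveFamily hδ).nonneg (1, x)

theorem next_t (P : PushFamily γ fun _ => 2) (x : X) : (P.next hδ).t x = P.t x + δ x := by
  change P.t x + ((1 : I) : ℝ) * δ x = _
  rw [Set.Icc.coe_one, one_mul]

/-- Over a constant path at the pole nothing moves. The limit of the steps is therefore strictly,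
not just up to homotopy, the identity on the fibre. -/
theorem next_e_of_const (P : PushFamily γ fun _ => 2) {x : X}
    (h : γ x = ContinuousMap.const I pole) : (P.next hδ).e x = Clutch.base (P.e x).outer := by
  change Clutch.transport _ (γ x _) (γ x _) (γ x _) = _
  rw [h]
  exact Clutch.transport_pole _

/-- The amount of stretching at a given time. -/
noncomputable def stretch (P : PushFamily γ m) (r : I) (x : X) : ℝ :=
  1 + r * Clutch.bump (P.pt x).rho

theorem one_le_stretch (P : PushFamily γ m) (r : I) (x : X) : 1 ≤ P.stretch r x :=
  le_add_of_nonneg_right (mul_nonneg r.2.1 (Clutch.bump _).2.1)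

theorem continuous_stretch (P : PushFamily γ m) :
    Continuous fun p : I × X => P.stretch p.1 p.2 := by
  have := P.continuous_pt
  unfold stretch
  fun_prop

theorem stretch_zero (P : PushFamily γ m) (x : X) : P.stretch 0 x = 1 := by simp [stretch]

theorem stretch_one (P : PushFamily γ m) (x : X) :
    P.stretch 1 x = 1 + Clutch.bump (P.pt x).rho := by simp [stretch]

/-- The stretching homotopy. -/
noncomputable def stretchFamily (P : PushFamily γ fun _ => 2) :
    PushFamily (cylinder γ) fun p => 2 * P.stretch p.1 p.2 where
  e p := Clutch.push (P.stretch p.1 p.2) (P.e p.2)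
  t p := P.t p.2
  continuous_e := (P.continuous_stretch).clutchPush (P.continuous_e.comp continuous_snd)
  continuous_t := P.continuous_t.comp continuous_snd
  proj p := by
    rw [Clutch.proj_push, ← P.proj, TwoSphere.push_push (P.one_le_stretch _ _) (by norm_num),
      mul_comm]
    rfl
  nonneg p := P.nonneg p.2

/-- The vertical homotopy. -/
noncomputable def verticalFamily (P : PushFamily γ fun _ => 2) :
    PushFamily (cylinder γ) fun p => 2 * P.stretch 1 p.2 where
  e p := Clutch.vertical (P.e p.2) (P.pt p.2) p.1
  t p := P.t p.2
  continuous_e := Clutch.continuous_vertical (P.continuous_e.comp continuous_snd)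
    (P.continuous_pt.comp continuous_snd) (fun p => P.proj p.2) continuous_fst
  continuous_t := P.continuous_t.comp continuous_snd
  proj p := by
    rw [stretch_one]
    exact Clutch.proj_vertical (P.proj p.2) _
  nonneg p := P.nonneg p.2

/-- The homotopy undoing the stretching. -/
noncomputable def shrinkFamily (P : PushFamily γ fun _ => 2) :
    PushFamily (cylinder γ) fun p => 2 * P.stretch (σ p.1) p.2 where
  e p := Clutch.shrink (P.e p.2) (P.pt p.2) p.1
  t p := P.t p.2
  continuous_e := Clutch.continuous_shrink (P.continuous_e.comp continuous_snd)
    (P.continuous_pt.comp continuous_snd) (fun p => P.proj p.2) continuous_fst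
  continuous_t := P.continuous_t.comp continuous_snd
  proj p := Clutch.proj_shrink (P.proj p.2) _
  nonneg p := P.nonneg p.2

/-- Four homotopies: stretching, which brings the intermediate radii over the pole; the deformation
of the fibre coordinate there; undoing the stretching; transport along the path. Points with `1 ≤
P.t x` stay over the pole with a constant remaining path, and their outer coordinate does not
change. -/
theorem homotopicRel_next (P : PushFamily γ fun _ => 2) (hγ : ∀ x, γ x 1 = pole) :
    (P.toMap hγ continuous_const).HomotopicRel ((P.next hδ).toMap hγ continuous_const)
      {x | 1 ≤ P.t x} := by
  have c1 : Continuous fun p : I × X => 2 * P.stretch p.1 p.2 :=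
    continuous_const.mul P.continuous_stretch
  have c2 : Continuous fun p : I × X => 2 * P.stretch 1 p.2 :=
    c1.comp (by fun_prop : Continuous fun p : I × X => ((1 : I), p.2))
  have c3 : Continuous fun p : I × X => 2 * P.stretch (σ p.1) p.2 :=
    c1.comp (by fun_prop : Continuous fun p : I × X => (σ p.1, p.2))
  have c0 (r : I) : Continuous fun x : X => (r, x) := by fun_prop
  refine (homotopicRel P.stretchFamily hγ c1 (fun x hx τ => ⟨hx, ?_⟩) (fun x => ?_)
    fun x => rfl).trans (g := ((P.stretchFamily.toMap (cylinder_one hγ) c1).comp ⟨_, c0 1⟩)) <|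
    (homotopicRel P.verticalFamily hγ c2 (fun x hx τ => ⟨hx, ?_⟩) (fun x => ?_)
    fun x => rfl).trans (g := ((P.verticalFamily.toMap (cylinder_one hγ) c2).comp ⟨_, c0 1⟩)) <|
    (homotopicRel P.shrinkFamily hγ c3 (fun x hx τ => ⟨hx, ?_⟩) (fun x => ?_)
    fun x => rfl).trans (g := ((P.shrinkFamily.toMap (cylinder_one hγ) c3).comp ⟨_, c0 1⟩)) <|
    homotopicRel (P.moveFamily hδ) hγ continuous_const (fun x hx τ => ⟨?_, ?_⟩) (fun x => ?_)
    fun x => rfl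
  · have hp : (P.e x).proj = pole := by
      rw [← P.proj, show γ x (clampI (P.t x)) = pole from P.pt_eq_pole hγ hx, push_pole]
    change (Clutch.push _ (P.e x)).outer = (Clutch.push _ (P.e x)).outer
    rw [outer_push_of_proj_eq_pole hp, outer_push_of_proj_eq_pole hp]
  · refine PushFamily.toMap_congr rfl ?_ rfl ?_
    · change Clutch.push (P.stretch 0 x) _ = _
      rw [stretch_zero, Clutch.push_of_le_one le_rfl]
    · change 2 * P.stretch 0 x = 2
      rw [stretch_zero, mul_one]
  · change (Clutch.vertical _ (P.pt x) _).outer = (Clutch.vertical _ (P.pt x) _).outer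
    rw [P.pt_eq_pole hγ hx, Clutch.vertical_pole, Clutch.vertical_pole]
  · refine PushFamily.toMap_congr (hγ' := cylinder_one hγ) (hn := c1) rfl ?_ rfl rfl
    change Clutch.vertical _ _ 0 = Clutch.push (P.stretch 1 x) _
    rw [stretch_one]
    exact Clutch.vertical_zero (P.proj x)
  · change (Clutch.shrink _ (P.pt x) _).outer = (Clutch.shrink _ (P.pt x) _).outer
    rw [P.pt_eq_pole hγ hx, Clutch.shrink_pole, Clutch.shrink_pole]
  · refine PushFamily.toMap_congr (hγ' := cylinder_one hγ) (hn := c2) rfl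
      Clutch.shrink_zero rfl ?_
    change 2 * P.stretch (σ 0) x = 2 * P.stretch 1 x
    rw [unitInterval.symm_zero]
  · exact le_add_of_le_of_nonneg hx (mul_nonneg τ.2.1 (hδ x).1.le)
  · have h (r : I) : (P.move (δ := δ) (r, x)).outer = (P.e x).outer := by
      rw [move, P.pt_eq_pole hγ hx, P.later_eq_pole hγ hx (mul_nonneg r.2.1 (hδ x).1.le),
        Clutch.transport_pole, Clutch.outer_base]
    exact (h τ).trans (h 0).symm
  · refine PushFamily.toMap_congr (hγ' := cylinder_one hγ) (hn := c3) rfl ?_ ?_ ?_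
    · change P.move (0, x) = Clutch.shrink (P.e x) (P.pt x) 1
      refine Eq.trans ?_ (Clutch.shrink_one (b := P.pt x) (P.proj x)).symm
      rw [move, Set.Icc.coe_zero, zero_mul, min_eq_left (delay _).2.1, zero_mul, later_zero]
    · change P.t x + ((0 : I) : ℝ) * δ x = P.t x
      rw [Set.Icc.coe_zero, zero_mul, add_zero]
    · change (2 : ℝ) = 2 * P.stretch (σ 1) x
      rw [unitInterval.symm_one, stretch_zero, mul_one]

end

end PushFamily

/-- Uniform continuity of the radius along a path gives a modulus which, with half the step and
three errors of `1/60`, serves all nearby paths. The admissible moduli of a path form an interval,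
so local choices can be averaged by a partition of unity on the path space. -/
theorem exists_isModulus :
    ∃ δ : C(C(I, TwoSphere), ℝ), ∀ γ, PushFamily.IsModulus γ (δ γ) := by
  refine exists_continuous_forall_mem_convex_of_local_const (t := fun γ =>
    {d | PushFamily.IsModulus γ d}) (fun γ => ?_) fun γ => ?_
  · refine Set.OrdConnected.convex ⟨fun a ha b hb c hc => ?_⟩
    exact ⟨ha.1.trans_le hc.1, fun s t h => hb.2 s t (h.trans hc.2)⟩
  · let ρ : C(TwoSphere, ℝ) := ⟨TwoSphere.rho, TwoSphere.continuous_rho⟩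
    have hu := CompactSpace.uniformContinuous_of_continuous (ρ.comp γ).continuous
    obtain ⟨d, hd, h⟩ := Metric.uniformContinuous_iff.1 hu (1 / 60) (by norm_num)
    -- Halving passes from the strict inequality of uniform continuity to the weak one in
    -- `IsModulus`.
    refine ⟨d / 2, ?_⟩
    have hc : Continuous fun γ' : C(I, TwoSphere) => ρ.comp γ' :=
      ContinuousMap.continuous_postcomp ρ
    have hb := hc.continuousAt.preimage_mem_nhds
      (Metric.ball_mem_nhds (ρ.comp γ) (by norm_num : (0 : ℝ) < 1 / 60))
    filter_upwards [hb] with γ' hγ'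
    refine ⟨by positivity, fun s t hst => ?_⟩
    have h1 := h (a := s) (b := t) (by
      rw [Subtype.dist_eq, Real.dist_eq]
      linarith)
    have h2 (r : I) := (ContinuousMap.dist_apply_le_dist (f := ρ.comp γ') (g := ρ.comp γ)
      r).trans_lt hγ'
    have h3 := h2 s
    have h4 := h2 t
    simp only [Real.dist_eq, abs_lt] at *
    change -(1 / 60) < (γ s).rho - (γ t).rho ∧ (γ s).rho - (γ t).rho < 1 / 60 at h1
    change -(1 / 60) < (γ' s).rho - (γ s).rho ∧ (γ' s).rho - (γ s).rho < 1 / 60 at h3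
    change -(1 / 60) < (γ' t).rho - (γ t).rho ∧ (γ' t).rho - (γ t).rho < 1 / 60 at h4
    constructor <;> linarith

/-! ### Iterated transport on the homotopy fibre. -/

namespace HoFiber

/-- The path of a point of the homotopy fibre. -/
def path : C(HoFiber, C(I, TwoSphere)) := ⟨fun y => y.1.2, by fun_prop⟩

theorem path_one (y : HoFiber) : path y 1 = TwoSphere.pole := y.2.2

/-- The homotopy from the identity to the start of the transport. -/
noncomputable def startFamily :
    PushFamily (PushFamily.cylinder path) fun p => 1 + p.1 where
  e p := Clutch.push (1 + p.1) p.2.1.1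
  t _ := 0
  continuous_e := by fun_prop
  continuous_t := continuous_const
  proj p := by
    rw [Clutch.proj_push, clampI_zero, ← p.2.2.1]
    rfl
  nonneg _ := le_rfl

/-- The start of the transport. -/
noncomputable def start : PushFamily path fun _ => 2 where
  e y := Clutch.push 2 y.1.1
  t _ := 0
  continuous_e := by fun_prop
  continuous_t := continuous_const
  proj y := by
    rw [Clutch.proj_push, clampI_zero, ← y.2.1]
    rfl
  nonneg _ := le_rfl

theorem homotopic_start :
    (ContinuousMap.id HoFiber).Homotopic (start.toMap path_one continuous_const) := by
  refine (PushFamily.homotopicRel (S := ∅) startFamily path_one (by fun_prop)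
    (fun x hx => hx.elim) (fun y => ?_) fun y => ?_).homotopic
  · refine Subtype.ext (Prod.ext ?_ (ContinuousMap.ext fun u => ?_))
    · change Clutch.push (1 + ((0 : I) : ℝ)) _ = _
      exact Clutch.push_of_le_one (by simp) _
    · change TwoSphere.push (1 + ((0 : I) : ℝ)) (y.1.2 (clampI (0 + u))) = y.1.2 u
      rw [TwoSphere.push_of_le_one (by simp), zero_add, clampI_coe]
  · have h : 1 + ((1 : I) : ℝ) = 2 := by norm_num
    refine PushFamily.toMap_congr rfl ?_ rfl h
    change Clutch.push (1 + ((1 : I) : ℝ)) _ = _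
    rw [h]
    rfl

variable {δ : C(C(I, TwoSphere), ℝ)} (hδ : ∀ γ, PushFamily.IsModulus γ (δ γ))

/-- Transport along the path in steps. -/
noncomputable def steps : ℕ → PushFamily path fun _ => 2
  | 0 => start
  | n + 1 => (steps n).next (δ := δ.comp path) fun y => hδ (path y)

theorem steps_t (n : ℕ) (y : HoFiber) : (steps hδ n).t y = n * δ (path y) := by
  induction n with
  | zero =>
    change (0 : ℝ) = _
    simp
  | succ n ih =>
    rw [steps, PushFamily.next_t, ih]
    push_cast
    rw [add_mul, one_mul]
    rfl

theorem steps_ofBase (n : ℕ) (z : RZ) : (steps hδ n).e (ofBase z) = Clutch.base z := by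
  induction n with
  | zero => exact Clutch.push_base _ _
  | succ n ih => rw [steps, PushFamily.next_e_of_const _ _ rfl, ih, Clutch.outer_base]

end HoFiber

/-- The fibre is homotopy equivalent to the homotopy fibre. -/
theorem nonempty_realization_homotopyEquiv_hoFiber : Nonempty (RZ ≃ₕ HoFiber) := by
  obtain ⟨δ, hδ⟩ := exists_isModulus
  let f (n : ℕ) : C(HoFiber, HoFiber) :=
    (HoFiber.steps hδ n).toMap HoFiber.path_one continuous_const
  obtain ⟨g, hg, hgf⟩ := exists_homotopic_limit (f := f)
    (S := fun n => {y | 1 ≤ (HoFiber.steps hδ n).t y})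
    (fun n => (HoFiber.steps hδ n).homotopicRel_next _ HoFiber.path_one)
    (fun n y hy => by
      change 1 ≤ (HoFiber.steps hδ (n + 1)).t y
      rw [HoFiber.steps, PushFamily.next_t]
      exact le_add_of_le_of_nonneg hy (hδ _).1.le)
    (fun y => by
      obtain ⟨n, hn⟩ := exists_nat_gt (1 / δ (HoFiber.path y))
      -- The strict inequality provides the open neighbourhood on which all points have arrived
      -- after `n` steps.
      have ho : IsOpen {y | 1 < (HoFiber.steps hδ n).t y} :=
        isOpen_lt continuous_const (HoFiber.steps hδ n).continuous_t
      refine ⟨n, Filter.mem_of_superset (ho.mem_nhds ?_) fun z hz => ?_⟩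
      · change 1 < (HoFiber.steps hδ n).t y
        rw [HoFiber.steps_t]
        exact (div_lt_iff₀ (hδ _).1).1 hn
      · exact le_of_lt (show 1 < (HoFiber.steps hδ n).t z from hz))
  have hlarge (y : HoFiber) : ∃ n, 1 ≤ (HoFiber.steps hδ n).t y := by
    obtain ⟨n, hn⟩ := exists_nat_gt (1 / δ (HoFiber.path y))
    refine ⟨n, ?_⟩
    rw [HoFiber.steps_t]
    exact ((div_lt_iff₀ (hδ _).1).1 hn).le
  have hg_base (y : HoFiber) : g y = HoFiber.ofBase (g y).1.1.outer := by
    obtain ⟨n, hn⟩ := hlarge y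
    rw [hgf n y hn]
    change (HoFiber.steps hδ n).toMap _ _ y =
      HoFiber.ofBase ((HoFiber.steps hδ n).toMap _ _ y).1.1.outer
    rw [PushFamily.toMap_eq_ofBase _ _ _ hn]
    exact congrArg HoFiber.ofBase (Clutch.outer_base _).symm
  have hproj (y : HoFiber) : (g y).1.1.proj = TwoSphere.pole := by
    rw [hg_base]
    exact (HoFiber.ofBase _).2.1.symm
  let r : C(HoFiber, RZ) := ⟨fun y => (g y).1.1.outer,
    Clutch.continuousOn_outer.comp_continuous (by fun_prop) fun y => by
      change 0 < (g y).1.1.proj.rho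
      rw [hproj, TwoSphere.rho_pole]
      exact one_pos⟩
  have hr : HoFiber.ofBase.comp r = g := ContinuousMap.ext fun y => (hg_base y).symm
  refine ⟨⟨HoFiber.ofBase, r, ?_, ?_⟩⟩
  -- This composite is equal to the identity, because every step fixes the fibre; only the other
  -- composite needs a homotopy.
  · suffices h : r.comp HoFiber.ofBase = ContinuousMap.id RZ by rw [h]
    refine ContinuousMap.ext fun z => ?_
    obtain ⟨n, hn⟩ := hlarge (HoFiber.ofBase z)
    change (g (HoFiber.ofBase z)).1.1.outer = z
    rw [hgf n _ hn]
    change ((HoFiber.steps hδ n).e (HoFiber.ofBase z)).outer = z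
    rw [HoFiber.steps_ofBase, Clutch.outer_base]
  · rw [hr]
    exact (HoFiber.homotopic_start.trans hg).symm

/-! ### Change of base point -/

/-- A homeomorphism carrying one base point to another induces a homeomorphism of loop spaces. -/
def Homeomorph.loops {X Y : Type*} [TopologicalSpace X] [TopologicalSpace Y] (h : X ≃ₜ Y) {x : X}
    {y : Y} (hxy : h x = y) : Path x x ≃ₜ Path y y where
  toFun p := (p.map h.continuous).cast hxy.symm hxy.symm
  invFun p := (p.map h.symm.continuous).cast (by simp [← hxy]) (by simp [← hxy])
  left_inv p := Path.ext (funext fun t => h.symm_apply_apply _)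
  right_inv p := Path.ext (funext fun t => h.apply_symm_apply _)
  continuous_toFun := continuous_induced_rng.2
    ((ContinuousMap.continuous_postcomp (h : C(X, Y))).comp continuous_induced_dom)
  continuous_invFun := continuous_induced_rng.2
    ((ContinuousMap.continuous_postcomp (h.symm : C(Y, X))).comp continuous_induced_dom)

/-- Two vectors of equal norm are exchanged by the reflection in the hyperplane orthogonal to their
difference; for `a = b` it is the identity. -/
theorem TwoSphere.exists_homeomorph_apply_eq (a b : TwoSphere) :
    ∃ h : TwoSphere ≃ₜ TwoSphere, h a = b := by
  let R := Submodule.reflection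
    (Submodule.span ℝ {(a : EuclideanSpace ℝ (Fin 3)) - b})ᗮ
  refine ⟨R.toHomeomorph.subtype fun v => by simp, Subtype.ext ?_⟩
  exact Submodule.reflection_sub (by simp)

/-- `|Z|` is homotopy equivalent to the loop space of the sphere at any base point. -/
theorem nonempty_realization_homotopyEquiv_loops (b : TwoSphere) :
    Nonempty (PrecubicalSet.final.{0}.Realization ≃ₕ Path b b) := by
  obtain ⟨e⟩ := nonempty_realization_homotopyEquiv_hoFiber
  obtain ⟨h, hb⟩ := TwoSphere.exists_homeomorph_apply_eq TwoSphere.pole b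
  exact ⟨(e.trans HoFiber.equivLoop).trans (h.loops hb).toHomotopyEquiv⟩

theorem mainTheorem7 :
    (∃ (fs : ∀ n : ℕ, C((PrecubicalSet.final.{0}.skeleton n).Realization,
          JamesStage (1 : Circle) n))
        (f : PrecubicalSet.final.{0}.Realization ≃ₜ James (1 : Circle)),
      (∀ (n : ℕ) (x : Fin n → I),
        fs n (PrecubicalSet.Realization.mk ⟨PUnit.unit, le_refl n⟩ x) = circleCubeMap n x) ∧
      (∀ (n : ℕ) (p : (PrecubicalSet.final.{0}.skeleton n).Realization),
        f ((PrecubicalSet.final.{0}.skeletonIncl n).realize p) =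
          James.ofStage (1 : Circle) n (fs n p))) ∧
    ∀ b : TwoSphere,
      Nonempty (PrecubicalSet.final.{0}.Realization ≃ₕ Path b b) :=
  ⟨realizationHomeoJames_skeleton, nonempty_realization_homotopyEquiv_loops⟩
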